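/- Let $p$ be an odd prime with $p\equiv 2\pmod 3$, let $k=\overline{\mathbb F}_p$, let $\zeta_6\in k$ be a primitive sixth root of unity and put $\zeta_3=\zeta_6^2$. Let $C$ be the smooth projective curve over $k$ with affine equation $y^2=x^6+1$, let $\infty_+,\infty_-$ be its two points at infinity, and identify $\mathrm{Jac}(C)$ (its group of $k$-points) with the group of degree-zero divisor classes of $C$. Let $E$ be the elliptic curve $y^2=x^3+1$, with $p$-power Frobenius $\pi_E$ and automorphism $\rho_3(x,y)=(\zeta_3x,y)$. Let $f,f':C\to E$ be the morphisms $f(x,y)=(x^2,y)$ and $f'(x,y)=(1/x^2,\,y/x^3)$. Let $\pi_C,\chi,\rho_6$ be the endomorphisms of $\mathrm{Jac}(C)$ induced (by push-forward of divisors) by the $p$-power Frobenius of $C$, by $(x,y)\mapsto(1/x,\,y/x^3)$ and by $(x,y)\mapsto(\zeta_6x,y)$, respectively. Then the maps $$\mu:E\times E\to\mathrm{Jac}(C),\quad (P,Q)\mapsto\big[f^*(P)+f'^*(Q)-2(\infty_++\infty_-)\big],$$ $$\tilde\mu:\mathrm{Jac}(C)\to E\times E,\quad \Big[\sum_i n_iP_i\Big]\mapsto\Big(\sum_i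 n_if(P_i),\ \sum_i n_if'(P_i)\Big)$$ and $\pi_C,\chi,\rho_6$ are well-defined homomorphisms, and with $T(\psi)=\tilde\mu\circ\psi\circ\mu$ for endomorphisms $\psi$ of $\mathrm{Jac}(C)$ one has, in $\mathrm{End}(E\times E)=M_2(\mathrm{End}(E))$, $$T(\pi_C)=2\begin{pmatrix}\pi_E&0\\0&\pi_E\end{pmatrix},\qquad T(\chi)=2\begin{pmatrix}0&1\\1&0\end{pmatrix},\qquad T(\rho_6)=2\begin{pmatrix}\rho_3&0\\0&-\rho_3^2\end{pmatrix}.$$ -/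

import Mathlib

open Polynomial

set_option linter.unusedSectionVars false

noncomputable section

namespace SexticJacobian

/-- An algebraic closure of the prime field `𝔽_p`. -/
abbrev Fbar (p : ℕ) [Fact p.Prime] : Type := AlgebraicClosure (ZMod p)

instance instDecidableEqFbar (p : ℕ) [Fact p.Prime] : DecidableEq (Fbar p) := Classical.decEq _

theorem two_ne_zero_Fbar (p : ℕ) [Fact p.Prime] [h : Fact (p ≠ 2)] : (2 : Fbar p) ≠ 0 := by
  intro h2
  have h3 : ((2 : ℕ) : Fbar p) = 0 := by exact_mod_cast h2
  rw [CharP.cast_eq_zero_iff (Fbar p) p] at h3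
  exact h.out ((Nat.prime_dvd_prime_iff_eq Fact.out Nat.prime_two).mp h3)

theorem three_ne_zero_Fbar (p : ℕ) [Fact p.Prime] [h : Fact (p % 3 = 2)] : (3 : Fbar p) ≠ 0 := by
  intro h2
  have h3 : ((3 : ℕ) : Fbar p) = 0 := by exact_mod_cast h2
  rw [CharP.cast_eq_zero_iff (Fbar p) p] at h3
  have h4 := (Nat.prime_dvd_prime_iff_eq Fact.out Nat.prime_three).mp h3
  have h5 := h.out
  rw [h4] at h5
  norm_num at h5

/-! ### The elliptic curve `E : y² = x³ + 1` -/

/-- The Weierstrass curve `y² = x³ + 1` over `𝔽_p`. -/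
def E (p : ℕ) [Fact p.Prime] : WeierstrassCurve (ZMod p) := ⟨0, 0, 0, 0, 1⟩

/-- The group `E(𝔽̄_p)`. -/
abbrev EPoint (p : ℕ) [Fact p.Prime] : Type := ((E p).baseChange (Fbar p)).toAffine.Point

theorem E_equation_iff {p : ℕ} [Fact p.Prime] (X Y : Fbar p) :
    ((E p).baseChange (Fbar p)).toAffine.Equation X Y ↔ Y ^ 2 = X ^ 3 + 1 := by
  rw [WeierstrassCurve.Affine.equation_iff]
  simp [E, WeierstrassCurve.baseChange, WeierstrassCurve.map]

section

variable {p : ℕ} [Fact p.Prime] [Fact (p ≠ 2)] [Fact (p % 3 = 2)]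

theorem E_nonsingular {X Y : Fbar p} (h : Y ^ 2 = X ^ 3 + 1) :
    ((E p).baseChange (Fbar p)).toAffine.Nonsingular X Y := by
  rw [WeierstrassCurve.Affine.nonsingular_iff]
  refine ⟨(E_equation_iff X Y).2 h, ?_⟩
  simp only [E, WeierstrassCurve.baseChange, WeierstrassCurve.map, map_zero, map_one]
  by_contra hc
  push Not at hc
  obtain ⟨h1, h2⟩ := hc
  have hX : X = 0 := by
    have : (3 : Fbar p) * X ^ 2 = 0 := by linear_combination -h1
    simpa [three_ne_zero_Fbar p] using this
  have hY : Y = 0 := by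
    have : (2 : Fbar p) * Y = 0 := by linear_combination h2
    simpa [two_ne_zero_Fbar p] using this
  rw [hX, hY] at h
  norm_num at h

/-- The affine point `(X, Y)` of `E`. -/
def ePoint (X Y : Fbar p) (h : Y ^ 2 = X ^ 3 + 1) : EPoint p :=
  WeierstrassCurve.Affine.Point.some X Y (E_nonsingular h)

end

/-- The `p`-power Frobenius endomorphism `(X, Y) ↦ (X ^ p, Y ^ p)` of `E`
(`frobeniusAlgHom` raises to the power `Fintype.card (ZMod p) = p`). -/
def piE (p : ℕ) [Fact p.Prime] : AddMonoid.End (EPoint p) :=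
  WeierstrassCurve.Affine.Point.map (W' := E p) (FiniteField.frobeniusAlgHom (ZMod p) (Fbar p))

/-- The automorphism `(X, Y) ↦ (z X, Y)` of `E`, for a cube root of unity `z`. -/
def rho3 (p : ℕ) [Fact p.Prime] [Fact (p ≠ 2)] [Fact (p % 3 = 2)] (z : Fbar p) (hz : z ^ 3 = 1) :
    AddMonoid.End (EPoint p) where
  toFun P := match P with
    | .zero => 0
    | .some X Y h => ePoint (z * X) Y
        (by rw [mul_pow, hz, one_mul]; exact (E_equation_iff X Y).1 h.1)
  map_zero' := rfl
  map_add' := by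
    have hz0 : z ≠ 0 := by rintro rfl; norm_num at hz
    rintro (_ | ⟨x₁, y₁, h₁⟩) (_ | ⟨x₂, y₂, h₂⟩)
    any_goals rfl
    have hneg : ∀ x y : Fbar p, ((E p).baseChange (Fbar p)).toAffine.negY x y = -y := by
      intro x y
      simp [E, WeierstrassCurve.baseChange, WeierstrassCurve.map, WeierstrassCurve.Affine.negY]
    by_cases hxy : x₁ = x₂ ∧ y₁ = ((E p).baseChange (Fbar p)).toAffine.negY x₂ y₂
    · rw [WeierstrassCurve.Affine.Point.add_of_Y_eq hxy.1 hxy.2]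
      refine (WeierstrassCurve.Affine.Point.add_of_Y_eq (by rw [hxy.1]) ?_).symm
      rw [hneg]; rw [hneg] at hxy; exact hxy.2
    · have hxy' : ¬ (z * x₁ = z * x₂ ∧
          y₁ = ((E p).baseChange (Fbar p)).toAffine.negY (z * x₂) y₂) := by
        rintro ⟨ha, hb⟩
        rw [hneg] at hb
        exact hxy ⟨mul_left_cancel₀ hz0 ha, by rw [hneg]; exact hb⟩
      rw [WeierstrassCurve.Affine.Point.add_some hxy]
      refine Eq.trans ?_ (WeierstrassCurve.Affine.Point.add_some hxy').symm
      have hs : ((E p).baseChange (Fbar p)).toAffine.slope (z * x₁) (z * x₂) y₁ y₂ =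
          z⁻¹ * ((E p).baseChange (Fbar p)).toAffine.slope x₁ x₂ y₁ y₂ := by
        by_cases hx : x₁ = x₂
        · subst hx
          have hy : y₁ ≠ ((E p).baseChange (Fbar p)).toAffine.negY x₁ y₂ := fun h => hxy ⟨rfl, h⟩
          have hy' : y₁ ≠ ((E p).baseChange (Fbar p)).toAffine.negY (z * x₁) y₂ :=
            fun h => hxy' ⟨rfl, h⟩
          rw [WeierstrassCurve.Affine.slope_of_Y_ne rfl hy,
            WeierstrassCurve.Affine.slope_of_Y_ne rfl hy', hneg, hneg]
          simp only [E, WeierstrassCurve.baseChange, WeierstrassCurve.map, map_zero]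
          have : z ^ 2 = z⁻¹ := by
            exact eq_inv_of_mul_eq_one_left (by linear_combination hz)
          rw [← this]; ring
        · rw [WeierstrassCurve.Affine.slope_of_X_ne hx, WeierstrassCurve.Affine.slope_of_X_ne
            (fun h => hx (mul_left_cancel₀ hz0 h)), ← mul_sub, div_mul_eq_div_div_swap,
            div_eq_inv_mul (_ / _)]
      have hi : (z⁻¹) ^ 2 = z := by
        have : z⁻¹ = z ^ 2 := by
          exact (eq_inv_of_mul_eq_one_left (by linear_combination hz)).symm
        rw [this]; linear_combination z * hz
      have hX : ∀ l, ((E p).baseChange (Fbar p)).toAffine.addX (z * x₁) (z * x₂) (z⁻¹ * l) =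
          z * ((E p).baseChange (Fbar p)).toAffine.addX x₁ x₂ l := by
        intro l
        simp only [E, WeierstrassCurve.baseChange, WeierstrassCurve.map, map_zero,
          WeierstrassCurve.Affine.addX]
        linear_combination l ^ 2 * hi
      have hY : ∀ l, ((E p).baseChange (Fbar p)).toAffine.addY (z * x₁) (z * x₂) y₁ (z⁻¹ * l) =
          ((E p).baseChange (Fbar p)).toAffine.addY x₁ x₂ y₁ l := by
        intro l
        simp only [WeierstrassCurve.Affine.addY, hneg, WeierstrassCurve.Affine.negAddY, hX]
        have : z⁻¹ * z = 1 := inv_mul_cancel₀ hz0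
        linear_combination (-l * (((E p).baseChange (Fbar p)).toAffine.addX x₁ x₂ l - x₁)) * this
      simp only [ePoint, hs, hX, hY]

theorem cube_sq_eq_one {p : ℕ} [Fact p.Prime] {ζ : Fbar p} (hζ : IsPrimitiveRoot ζ 6) :
    (ζ ^ 2) ^ 3 = 1 := by
  rw [← pow_mul]
  exact hζ.pow_eq_one

/-- The endomorphism of `A × A` given by a `2 × 2` matrix of endomorphisms of `A`, acting on
column vectors. -/
def matrixEnd {A : Type*} [AddCommGroup A] (M : Matrix (Fin 2) (Fin 2) (AddMonoid.End A)) :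
    AddMonoid.End (A × A) :=
  AddMonoidHom.prod
    (AddMonoidHom.coprod (M 0 0) (M 0 1))
    (AddMonoidHom.coprod (M 1 0) (M 1 1))

/-! ### The curve `C : y² = x⁶ + 1` -/

/-- The points over `𝔽̄_p` of the smooth projective curve `C` with affine equation `y² = x⁶ + 1`:
it is glued from the two charts `y² = x⁶ + 1` and `s² = 1 + t⁶` by `t = 1 / x`, `s = y / x³`, so
there are two points at infinity, at which `t = 0` and `s = ±1`. -/
inductive CPoint (p : ℕ) [Fact p.Prime] : Type
  | affine (a b : Fbar p) (h : b ^ 2 = a ^ 6 + 1) : CPoint p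
  | infty (s : Fbar p) (h : s ^ 2 = 1) : CPoint p

/-- The affine coordinate ring `𝔽̄_p[x, y] / (y² - (x⁶ + 1))` of `C`. -/
abbrev CoordRing (p : ℕ) [Fact p.Prime] : Type :=
  AdjoinRoot (X ^ 2 - C (X ^ 6 + 1) : (Fbar p)[X][X])

section

variable (p : ℕ) [Fact p.Prime] [Fact (p ≠ 2)] [Fact (p % 3 = 2)]

theorem irreducible_curve : Irreducible (X ^ 2 - C (X ^ 6 + 1) : (Fbar p)[X][X]) := by
  have hm : (X ^ 2 - C (X ^ 6 + 1) : (Fbar p)[X][X]).Monic := monic_X_pow_sub_C _ two_ne_zero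
  have hd : (X ^ 2 - C (X ^ 6 + 1) : (Fbar p)[X][X]).natDegree = 2 := natDegree_X_pow_sub_C
  by_contra h
  obtain ⟨f, g, h0, h1⟩ := (hm.not_irreducible_iff_exists_add_mul_eq_coeff hd).mp h
  have h0' : f * g = -(X ^ 6 + 1) := by
    rw [← h0, coeff_sub, coeff_C_zero, coeff_X_pow]; simp
  have h1' : f + g = 0 := by
    rw [← h1, coeff_sub, coeff_C_of_ne_zero one_ne_zero, coeff_X_pow]; simp
  have hf : f * f = X ^ 6 + 1 := by linear_combination f * h1' - h0'
  have h6 : ((6 : ℕ) : Fbar p) ≠ 0 := by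
    have : ((6 : ℕ) : Fbar p) = 2 * 3 := by norm_num
    rw [this]
    exact mul_ne_zero (two_ne_zero_Fbar p) (three_ne_zero_Fbar p)
  have hs : (X ^ 6 - C (-1) : (Fbar p)[X]).Separable := separable_X_pow_sub_C _ h6 (by simp)
  have hu : IsUnit f := hs.squarefree f ⟨1, by rw [hf]; simp⟩
  have h3 : (X ^ 6 - C (-1) : (Fbar p)[X]).natDegree = 6 := natDegree_X_pow_sub_C
  have h4 : (X ^ 6 - C (-1) : (Fbar p)[X]) = f * f := by rw [hf]; simp
  rw [h4, natDegree_mul hu.ne_zero hu.ne_zero, natDegree_eq_zero_of_isUnit hu] at h3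
  norm_num at h3

instance instIsDomainCoordRing : IsDomain (CoordRing p) :=
  AdjoinRoot.isDomain_of_prime (irreducible_curve p).prime

/-- The function field of `C` over `𝔽̄_p`. -/
abbrev FunctionField : Type := FractionRing (CoordRing p)

/-- The coordinate function `x` on `C`. -/
def xFun : FunctionField p := algebraMap (CoordRing p) _ (AdjoinRoot.of _ X)

/-- The coordinate function `y` on `C`. -/
def yFun : FunctionField p := algebraMap (CoordRing p) _ (AdjoinRoot.root _)

/-- The chart coordinates at a point: `(x, y)` at an affine point and `(1 / x, y / x³)` at a point
at infinity. -/
def chart : CPoint p → Fin 2 → FunctionField p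
  | .affine _ _ _ => ![xFun p, yFun p]
  | .infty _ _ => ![(xFun p)⁻¹, yFun p / xFun p ^ 3]

/-- The values at a point of the chart coordinates at this point. -/
def chartValue : CPoint p → Fin 2 → Fbar p
  | .affine a b _ => ![a, b]
  | .infty s _ => ![0, s]

variable {p}

/-- `u` is a unit of the local ring of `C` at `P`: a quotient of two polynomials in the chart
coordinates, neither of which vanishes at `P`. -/
def IsUnitAt (P : CPoint p) (u : FunctionField p) : Prop :=
  ∃ g h : MvPolynomial (Fin 2) (Fbar p),
    MvPolynomial.eval (chartValue p P) g ≠ 0 ∧ MvPolynomial.eval (chartValue p P) h ≠ 0 ∧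
      u = MvPolynomial.aeval (chart p P) g / MvPolynomial.aeval (chart p P) h

/-- A uniformizer of the local ring of `C` at a point. -/
def uniformizer : CPoint p → FunctionField p
  | .affine a b _ => if b = 0 then yFun p else xFun p - algebraMap (Fbar p) _ a
  | .infty _ _ => (xFun p)⁻¹

/-- The function `φ` has order `n` at `P`, i.e. `φ = tⁿ u` with `t` a uniformizer and `u` a unit of
the local ring at `P`. -/
def HasOrd (P : CPoint p) (φ : FunctionField p) (n : ℤ) : Prop :=
  ∃ u, IsUnitAt P u ∧ φ = uniformizer P ^ n * u

/-! ### Divisors and the Jacobian -/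

variable (p)

/-- Divisors on `C`. -/
abbrev Divisor : Type := CPoint p →₀ ℤ

/-- The degree of a divisor. -/
def degree : Divisor p →+ ℤ := Finsupp.liftAddHom fun _ => AddMonoidHom.id ℤ

/-- Divisors of degree zero. -/
abbrev DivisorZero : AddSubgroup (Divisor p) := (degree p).ker

variable {p}

theorem IsUnitAt.one (P : CPoint p) : IsUnitAt P 1 := ⟨1, 1, by simp, by simp, by simp⟩

theorem IsUnitAt.mul {P : CPoint p} {u v : FunctionField p} (hu : IsUnitAt P u)
    (hv : IsUnitAt P v) : IsUnitAt P (u * v) := by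
  obtain ⟨g, h, hg, hh, rfl⟩ := hu
  obtain ⟨g', h', hg', hh', rfl⟩ := hv
  exact ⟨g * g', h * h', by simpa using ⟨hg, hg'⟩, by simpa using ⟨hh, hh'⟩, by
    rw [map_mul, map_mul, div_mul_div_comm]⟩

theorem IsUnitAt.inv {P : CPoint p} {u : FunctionField p} (hu : IsUnitAt P u) :
    IsUnitAt P u⁻¹ := by
  obtain ⟨g, h, hg, hh, rfl⟩ := hu
  exact ⟨h, g, hh, hg, by rw [inv_div]⟩

theorem of_ne_zero {g : (Fbar p)[X]} (hg : g ≠ 0) :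
    algebraMap (CoordRing p) (FunctionField p) (AdjoinRoot.of _ g) ≠ 0 := by
  have h1 : AdjoinRoot.of (X ^ 2 - C (X ^ 6 + 1) : (Fbar p)[X][X]) g ≠ 0 := by
    intro h
    refine hg (AdjoinRoot.of.injective_of_degree_ne_zero ?_ (h.trans (map_zero _).symm))
    rw [degree_X_pow_sub_C two_pos]
    norm_num
  intro h
  exact h1 (IsFractionRing.injective (CoordRing p) (FunctionField p) (h.trans (map_zero _).symm))

theorem xFun_ne_algebraMap (a : Fbar p) : xFun p ≠ algebraMap (Fbar p) _ a := by
  intro h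
  refine of_ne_zero (X_sub_C_ne_zero a) ?_
  rw [map_sub, map_sub]
  exact sub_eq_zero.2 h

theorem yFun_sq : yFun p ^ 2 = xFun p ^ 6 + 1 := by
  have h := AdjoinRoot.eval₂_root (X ^ 2 - C (X ^ 6 + 1) : (Fbar p)[X][X])
  rw [eval₂_sub, eval₂_pow, eval₂_X, eval₂_C, sub_eq_zero] at h
  rw [yFun, ← map_pow, h, xFun]
  simp only [map_add, map_pow, map_one]

theorem yFun_ne_zero : yFun p ≠ 0 := by
  intro h
  have h2 := yFun_sq (p := p)
  refine of_ne_zero (p := p) (g := X ^ 6 - C (-1)) (X_pow_sub_C_ne_zero (by norm_num) _) ?_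
  rw [h] at h2
  simpa [xFun] using h2.symm

theorem uniformizer_ne_zero (P : CPoint p) : uniformizer P ≠ 0 := by
  cases P with
  | affine a b h =>
    rw [uniformizer]
    split_ifs
    · exact yFun_ne_zero
    · exact sub_ne_zero.2 (xFun_ne_algebraMap a)
  | infty s h =>
    exact inv_ne_zero (by simpa using xFun_ne_algebraMap (p := p) 0)

variable (p)

/-- Principal divisors: the divisors of the nonzero functions on `C`. -/
def Principal : AddSubgroup (Divisor p) where
  carrier := {D | ∃ φ : FunctionField p, φ ≠ 0 ∧ ∀ P, HasOrd P φ (D P)}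
  zero_mem' := ⟨1, one_ne_zero, fun P => ⟨1, IsUnitAt.one P, by simp⟩⟩
  add_mem' := by
    rintro D D' ⟨φ, hφ, h⟩ ⟨ψ, hψ, h'⟩
    refine ⟨φ * ψ, mul_ne_zero hφ hψ, fun P => ?_⟩
    obtain ⟨u, hu, e⟩ := h P
    obtain ⟨v, hv, e'⟩ := h' P
    refine ⟨u * v, hu.mul hv, ?_⟩
    rw [e, e', Finsupp.add_apply, zpow_add₀ (uniformizer_ne_zero P)]
    ring
  neg_mem' := by
    rintro D ⟨φ, hφ, h⟩
    refine ⟨φ⁻¹, inv_ne_zero hφ, fun P => ?_⟩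
    obtain ⟨u, hu, e⟩ := h P
    refine ⟨u⁻¹, hu.inv, ?_⟩
    rw [e, Finsupp.neg_apply, zpow_neg, mul_inv]

/-- The Jacobian of `C` (its group of points over `𝔽̄_p`): the group of classes of divisors of
degree zero modulo principal divisors. -/
abbrev Jac : Type := DivisorZero p ⧸ (Principal p).addSubgroupOf (DivisorZero p)

variable {p}

/-- The homomorphism induced on `Jac(C)` by a homomorphism `F` on divisors of degree zero that kills
principal divisors (and `0` if `F` does not; that this does not happen for the maps `F` used here is
part of the theorem). -/
def induced {G : Type*} [AddCommGroup G] (F : DivisorZero p →+ G) : Jac p →+ G :=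
  open Classical in
  if h : (Principal p).addSubgroupOf (DivisorZero p) ≤ F.ker then QuotientAddGroup.lift _ F h else 0

/-- The divisor class of a divisor of degree zero (and `0` for other divisors). -/
def divisorClass (D : Divisor p) : Jac p :=
  open Classical in
  if h : D ∈ DivisorZero p then QuotientAddGroup.mk ⟨D, h⟩ else 0

/-- The push-forward of divisors of degree zero by a map `α : C → C`:
`∑ n_P P ↦ ∑ n_P α(P)`. -/
def pushDivisor (α : CPoint p → CPoint p) : DivisorZero p →+ DivisorZero p :=
  ((Finsupp.mapDomain.addMonoidHom α).comp (DivisorZero p).subtype).codRestrict (DivisorZero p) (by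
    rintro ⟨D, hD⟩
    rw [AddMonoidHom.mem_ker] at hD ⊢
    rw [← hD]
    simp [degree, Finsupp.sum_mapDomain_index]
    rfl)

/-- The endomorphism of `Jac(C)` induced by a map `α : C → C`. -/
def inducedEnd (α : CPoint p → CPoint p) : AddMonoid.End (Jac p) :=
  induced ((QuotientAddGroup.mk' _).comp (pushDivisor α))

/-! ### The endomorphisms `π_C`, `χ` and `ρ₆` -/

variable (p)

/-- The `p`-power Frobenius map of `C`. -/
def frobC : CPoint p → CPoint p
  | .affine a b h => .affine (a ^ p) (b ^ p) (by
      rw [← pow_mul, mul_comm p 2, pow_mul, h, add_pow_char, one_pow, ← pow_mul, ← pow_mul,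
        mul_comm 6 p])
  | .infty s h => .infty (s ^ p) (by rw [← pow_mul, mul_comm p 2, pow_mul, h, one_pow])

/-- The automorphism `(x, y) ↦ (1 / x, y / x³)` of `C`. -/
def chiC : CPoint p → CPoint p
  | .affine a b h =>
    if ha : a = 0 then .infty b (by rw [h, ha]; norm_num)
    else .affine (1 / a) (b / a ^ 3) (by rw [div_pow, h]; field_simp; ring)
  | .infty s h => .affine 0 s (by rw [h]; norm_num)

variable {p}

/-- The automorphism `(x, y) ↦ (ζ x, y)` of `C`, for a sixth root of unity `ζ`. -/
def rhoC (ζ : Fbar p) (hζ : ζ ^ 6 = 1) : CPoint p → CPoint p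
  | .affine a b h => .affine (ζ * a) b (by rw [mul_pow, hζ, one_mul, h])
  | .infty s h => .infty (s / ζ ^ 3) (by rw [div_pow, h, ← pow_mul, hζ, div_one])

variable (p)

/-- The Frobenius endomorphism of `Jac(C)`. -/
def piJac : AddMonoid.End (Jac p) := inducedEnd (frobC p)

/-- The endomorphism of `Jac(C)` induced by `(x, y) ↦ (1 / x, y / x³)`. -/
def chiJac : AddMonoid.End (Jac p) := inducedEnd (chiC p)

variable {p}

/-- The endomorphism of `Jac(C)` induced by `(x, y) ↦ (ζ x, y)`. -/
def rho6Jac (ζ : Fbar p) (hζ : ζ ^ 6 = 1) : AddMonoid.End (Jac p) := inducedEnd (rhoC ζ hζ)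

/-! ### The morphisms `f, f' : C → E` -/

variable (p)

/-- The morphism `f : C → E`, `(x, y) ↦ (x², y)`. -/
def fMap : CPoint p → EPoint p
  | .affine a b h => ePoint (a ^ 2) b (by rw [h]; ring)
  | .infty _ _ => 0

/-- The morphism `f' : C → E`, `(x, y) ↦ (1 / x², y / x³)`. -/
def fMap' : CPoint p → EPoint p
  | .affine a b h =>
    if ha : a = 0 then 0
    else ePoint (1 / a ^ 2) (b / a ^ 3) (by rw [div_pow, h]; field_simp; ring)
  | .infty s h => ePoint 0 s (by rw [h]; norm_num)

variable {p}

/-- The composition with `(U, V) : C → E` of a uniformizer of the local ring of `E` at `P`. The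
uniformizer is `X / Y` at the origin, and `Y` or `X - X₀` at an affine point `(X₀, Y₀)`, according
to whether `Y₀ = 0` or not. -/
def uniformizerE (U V : FunctionField p) : EPoint p → FunctionField p
  | .zero => U / V
  | .some X₀ Y₀ _ => if Y₀ = 0 then V else U - algebraMap (Fbar p) _ X₀

/-- `D` is the pull-back of the point `P` by the morphism `g = (U, V) : C → E`, i.e. the fibre
`g⁻¹(P)`, each point `Q` of it counted with its ramification index, which is the order at `Q` of
the composition with `g` of a uniformizer at `P`. -/
def IsPullback (g : CPoint p → EPoint p) (U V : FunctionField p) (P : EPoint p)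
    (D : Divisor p) : Prop :=
  ∀ Q, (g Q = P → HasOrd Q (uniformizerE U V P) (D Q)) ∧ (g Q ≠ P → D Q = 0)

/-- The pull-back of the point `P` by the morphism `g = (U, V) : C → E`. -/
def pullback (g : CPoint p → EPoint p) (U V : FunctionField p) (P : EPoint p) : Divisor p :=
  open Classical in
  if h : ∃ D, IsPullback g U V P D then h.choose else 0

/-- The pull-back `f^*(P)`. -/
def fPull (P : EPoint p) : Divisor p := pullback (fMap p) (xFun p ^ 2) (yFun p) P

/-- The pull-back `f'^*(P)`. -/
def fPull' (P : EPoint p) : Divisor p :=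
  pullback (fMap' p) (1 / xFun p ^ 2) (yFun p / xFun p ^ 3) P

/-! ### The homomorphisms `μ`, `μ̃` and `T` -/

variable (p)

/-- The sum of the two points at infinity of `C`. -/
def divInfty : Divisor p :=
  Finsupp.single (.infty 1 (one_pow 2)) 1 + Finsupp.single (.infty (-1) neg_one_sq) 1

variable {p}

/-- The divisor `f^*(P) + f'^*(Q) - 2 (∞₊ + ∞₋)`. -/
def muDivisor (R : EPoint p × EPoint p) : Divisor p :=
  fPull R.1 + fPull' R.2 - 2 • divInfty p

variable (p)

/-- The homomorphism `μ : E × E → Jac(C)`, `(P, Q) ↦ [f^*(P) + f'^*(Q) - 2 (∞₊ + ∞₋)]`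
(that this formula is additive, so that the value `0` of the other case is not taken, is part of the
theorem). -/
def mu : EPoint p × EPoint p →+ Jac p :=
  open Classical in
  if h : ∀ R S : EPoint p × EPoint p,
      divisorClass (muDivisor (R + S)) = divisorClass (muDivisor R) + divisorClass (muDivisor S)
  then AddMonoidHom.mk' (fun R => divisorClass (muDivisor R)) h else 0

/-- The homomorphism `∑ n_P P ↦ (∑ n_P f(P), ∑ n_P f'(P))` on divisors of degree zero. -/
def muTildeDivisor : DivisorZero p →+ EPoint p × EPoint p :=
  (AddMonoidHom.prod
    (Finsupp.liftAddHom fun P => (zmultiplesHom (EPoint p)) (fMap p P))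
    (Finsupp.liftAddHom fun P => (zmultiplesHom (EPoint p)) (fMap' p P))).comp
    (DivisorZero p).subtype

/-- The homomorphism `μ̃ = (f_*, f'_*) : Jac(C) → E × E`. -/
def muTilde : Jac p →+ EPoint p × EPoint p := induced (muTildeDivisor p)

/-- The homomorphism `T : End(Jac(C)) → End(E × E)`, `ψ ↦ μ̃ ∘ ψ ∘ μ`. -/
def T : AddMonoid.End (Jac p) →+ AddMonoid.End (EPoint p × EPoint p) where
  toFun ψ := (muTilde p).comp (AddMonoidHom.comp ψ (mu p))
  map_zero' := by
    apply AddMonoidHom.ext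
    intro R
    exact (muTilde p).map_zero
  map_add' ψ ψ' := by
    apply AddMonoidHom.ext
    intro R
    exact (muTilde p).map_add _ _

end

end SexticJacobian

end

open SexticJacobian

/-! Each of the three maps `α` of `C` satisfies `(f, f') ∘ α = M ∘ (f, f')` with `M` the stated
matrix, so `μ̃ ∘ α_* = M ∘ μ̃`. Moreover `μ̃ ∘ μ = 2`. Hence `T(α_*) = μ̃ ∘ α_* ∘ μ = M ∘ μ̃ ∘ μ =
2M` (`T_inducedEnd`).

For `μ̃ ∘ μ = 2` (`fSum_muDivisor`) let `ι(x, y) = (-x, y)`. The fibres of `f` are the orbits of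
`ι`, so `f_* f^* = 2`, while `f' ∘ ι = -f'` gives `f'_* f^* = 0`. Since `f' = f ∘ χ`, the other two
entries follow by symmetry. The constant `∞₊ + ∞₋` equals `f^*(0)` and contributes zero.

Most of the work is well-definedness. The maps `α` preserve principal divisors because each comes
with an endomorphism of the function field that carries orders at `P` to orders at `α(P)`
(`mapDomain_mem_principal`). The map `μ̃` kills principal divisors because `φ · ι^*φ` is the
pull-back of a function `ψ` on `E` whose affine divisor is that of `f_* div φ`, and the points of a
principal divisor on `E` sum to zero (`sum_fMap_eq_zero`). The latter rests on unique factorization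
of ideals in the coordinate ring of `E` and on the injectivity of `E → Cl`. Finally `μ` is additive
because `(P) + (Q) - (P + Q) - (0)` is the divisor of a quotient of lines on `E`, which is pulled
back by `f` (`fPull_add_mem_principal`) and carried to `f'` by `χ`; the remaining discrepancy is
`div x`. -/

noncomputable section

namespace SexticJacobian

/-! ### Noetherian domains with invertible maximal ideals. -/

section Dedekind

open FractionalIdeal nonZeroDivisors

variable {A : Type*} [CommRing A] [IsDomain A] [IsNoetherianRing A]

/-- If the maximal ideals of a Noetherian domain are invertible, then so are all nonzero ideals. -/
theorem isUnit_coeIdeal_of_isMaximal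
    (h : ∀ M : Ideal A, M.IsMaximal → M ≠ ⊥ → IsUnit (M : FractionalIdeal A⁰ (FractionRing A)))
    (I : Ideal A) (hI : I ≠ ⊥) : IsUnit (I : FractionalIdeal A⁰ (FractionRing A)) := by
  revert hI
  induction I using IsNoetherian.induction with
  | hgt I ih =>
    intro hI
    by_cases htop : I = ⊤
    · rw [htop, coeIdeal_top]; exact isUnit_one
    obtain ⟨M, hM, hIM⟩ := Ideal.exists_le_maximal I htop
    have hM0 : M ≠ ⊥ := fun h0 => hI (le_bot_iff.1 (h0 ▸ hIM))
    obtain ⟨u, hu⟩ := h M hM hM0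
    -- Since `I ≤ M`, the fractional ideal `I M⁻¹` is an integral ideal `J`. It is strictly larger
    -- than `I`, so the Noetherian induction applies to it.
    have hle : (I : FractionalIdeal A⁰ (FractionRing A)) * ↑u⁻¹ ≤ 1 := by
      calc (I : FractionalIdeal A⁰ (FractionRing A)) * ↑u⁻¹ ≤ M * ↑u⁻¹ :=
            mul_le_mul_left (coeIdeal_le_coeIdeal _ |>.2 hIM) _
        _ = 1 := by rw [← hu, Units.mul_inv]
    obtain ⟨J, hJ⟩ := le_one_iff_exists_coeIdeal.1 hle
    have hIJ : I = J * M := by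
      rw [← coeIdeal_inj (K := FractionRing A), coeIdeal_mul, hJ, ← hu, mul_assoc, Units.inv_mul,
        mul_one]
    have hlt : I < J := by
      -- If `J = I`, then `I = M I`, and Nakayama's lemma gives `r ≡ 1` modulo `M` that kills `I`.
      -- In a domain `r = 0`, so `1 ∈ M`.
      refine lt_of_le_of_ne (hIJ ▸ Ideal.mul_le_left) fun he => ?_
      have hs : I ≤ M • I := by
        rw [smul_eq_mul, mul_comm]
        exact le_of_eq (hIJ.trans (by rw [← he]))
      obtain ⟨r, hr, hr0⟩ := Submodule.exists_sub_one_mem_and_smul_eq_zero_of_fg_of_le_smul M I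
        (IsNoetherian.noetherian I) hs
      obtain ⟨i, hi, hi0⟩ := Submodule.exists_mem_ne_zero_of_ne_bot hI
      have : r = 0 := by simpa [hi0] using hr0 i hi
      refine hM.ne_top ((Ideal.eq_top_iff_one M).2 ?_)
      simpa [this] using hr
    have hJ0 : J ≠ ⊥ := fun h0 => hI (by rw [hIJ, h0, Ideal.bot_mul])
    rw [hIJ, coeIdeal_mul]
    exact (ih J hlt hJ0).mul (h M hM hM0)

/-- A Noetherian domain is a Dedekind domain if its maximal ideals are invertible. -/
theorem isDedekindDomain_of_isMaximal_isUnit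
    (h : ∀ M : Ideal A, M.IsMaximal → M ≠ ⊥ → IsUnit (M : FractionalIdeal A⁰ (FractionRing A))) :
    IsDedekindDomain A := by
  refine (isDedekindDomain_iff_mul_inv_cancel (K := FractionRing A)).2 ?_
  intro I hI
  rw [mul_inv_cancel_iff_isUnit]
  obtain ⟨a, J, ha, rfl⟩ := exists_eq_spanSingleton_mul I
  have ha' : algebraMap A (FractionRing A) a ≠ 0 := by simpa using ha
  refine IsUnit.mul ?_ (isUnit_coeIdeal_of_isMaximal h J ?_)
  · refine IsUnit.of_mul_eq_one (spanSingleton A⁰ (algebraMap A (FractionRing A) a)) ?_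
    rw [spanSingleton_mul_spanSingleton, inv_mul_cancel₀ ha', spanSingleton_one]
  · rintro rfl
    exact hI (by simp)

end Dedekind

/-! ### Ideals, orders and principal divisors on an elliptic curve. -/

section Weierstrass

open WeierstrassCurve WeierstrassCurve.Affine FractionalIdeal nonZeroDivisors
open IsDedekindDomain (HeightOneSpectrum)

variable {F : Type*} [Field F] {W : WeierstrassCurve.Affine F}

theorem XYIdeal_isMaximal {x y : F} (h : W.Equation x y) :
    (CoordinateRing.XYIdeal W x (C y)).IsMaximal :=
  Ideal.Quotient.maximal_of_isField _
    ((CoordinateRing.quotientXYIdealEquiv (W' := W) (x := x) (y := C y) h).toMulEquiv.isField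
      (Field.toIsField F))

theorem XClass_mem_XYIdeal (x : F) (y : F[X]) :
    CoordinateRing.XClass W x ∈ CoordinateRing.XYIdeal W x y :=
  Ideal.subset_span (by simp)

theorem YClass_mem_XYIdeal (x : F) (y : F[X]) :
    CoordinateRing.YClass W y ∈ CoordinateRing.XYIdeal W x y :=
  Ideal.subset_span (by simp)

theorem XYIdeal_ne_bot (x : F) (y : F[X]) : CoordinateRing.XYIdeal W x y ≠ ⊥ := fun h =>
  CoordinateRing.XClass_ne_zero (W' := W) x (by simpa [h] using XClass_mem_XYIdeal (W := W) x y)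

/-- If the ideals agree, they contain the constants `x' - x` and `y' - y`, as differences of
generators. A nonzero constant is a unit and cannot lie in a maximal ideal. -/
theorem XYIdeal_injective {x y x' y' : F} (h : W.Equation x y)
    (he : CoordinateRing.XYIdeal W x (C y) = CoordinateRing.XYIdeal W x' (C y')) :
    x = x' ∧ y = y' := by
  have key : ∀ c : F, algebraMap F W.CoordinateRing c ∈ CoordinateRing.XYIdeal W x (C y) →
      c = 0 := by
    intro c hc
    by_contra h0
    exact (XYIdeal_isMaximal h).ne_top
      (Ideal.eq_top_of_isUnit_mem _ hc ((isUnit_iff_ne_zero.2 h0).map _))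
  constructor
  · refine (sub_eq_zero.1 (key (x' - x) ?_)).symm
    have := Ideal.sub_mem _ (XClass_mem_XYIdeal (W := W) x (C y))
      (he ▸ XClass_mem_XYIdeal (W := W) x' (C y'))
    convert this using 1
    rw [CoordinateRing.XClass, CoordinateRing.XClass, ← map_sub]
    change CoordinateRing.mk W (C (C (x' - x))) = _
    congr 1
    simp
  · refine (sub_eq_zero.1 (key (y' - y) ?_)).symm
    have := Ideal.sub_mem _ (YClass_mem_XYIdeal (W := W) x (C y))
      (he ▸ YClass_mem_XYIdeal (W := W) x' (C y'))
    convert this using 1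
    rw [CoordinateRing.YClass, CoordinateRing.YClass, ← map_sub]
    change CoordinateRing.mk W (C (C (y' - y))) = _
    congr 1
    simp

/-- The maximal ideals of the coordinate ring over an algebraically closed field are the ideals of
the points. -/
theorem exists_eq_XYIdeal [IsAlgClosed F] (M : Ideal W.CoordinateRing) (hM : M.IsMaximal) :
    ∃ x y, W.Equation x y ∧ M = CoordinateRing.XYIdeal W x (C y) := by
  let _ : Field (W.CoordinateRing ⧸ M) := Ideal.Quotient.field M
  have : Algebra.FiniteType F[X] W.CoordinateRing := inferInstance
  have : Algebra.FiniteType F W.CoordinateRing := Algebra.FiniteType.trans (S := F[X])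
    inferInstance inferInstance
  have : Algebra.FiniteType F (W.CoordinateRing ⧸ M) := inferInstance
  -- Zariski's lemma: the residue field is finite over `F`, hence equal to `F`. The residues of the
  -- two coordinates are then the coordinates of the point.
  have : Module.Finite F (W.CoordinateRing ⧸ M) := finite_of_finite_type_of_isJacobsonRing _ _
  have hb := IsAlgClosed.algebraMap_bijective_of_isIntegral (k := F) (K := W.CoordinateRing ⧸ M)
  obtain ⟨x, hx⟩ := hb.2 (Ideal.Quotient.mk M (CoordinateRing.mk W (C X)))
  obtain ⟨y, hy⟩ := hb.2 (Ideal.Quotient.mk M (CoordinateRing.mk W X))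
  have hval : ∀ g : F[X][X], Ideal.Quotient.mk M (CoordinateRing.mk W g) =
      algebraMap F (W.CoordinateRing ⧸ M) (g.evalEval x y) := by
    intro g
    have : (Ideal.Quotient.mk M).comp (CoordinateRing.mk W) =
        (algebraMap F (W.CoordinateRing ⧸ M)).comp (evalEvalRingHom x y) := by
      refine Polynomial.ringHom_ext' (Polynomial.ringHom_ext' ?_ ?_) ?_
      · ext c
        simp
        rfl
      · simp [hx]
      · simp [hy]
    exact RingHom.congr_fun this g
  have heq : W.Equation x y := by
    apply hb.1
    rw [← hval, map_zero]
    have : CoordinateRing.mk W W.polynomial = 0 := AdjoinRoot.mk_self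
    rw [this, map_zero]
  refine ⟨x, y, heq, ((XYIdeal_isMaximal heq).eq_of_le hM.ne_top ?_).symm⟩
  rw [CoordinateRing.XYIdeal, Ideal.span_le]
  rintro r (rfl | rfl)
  · rw [SetLike.mem_coe, ← Ideal.Quotient.eq_zero_iff_mem, CoordinateRing.XClass, hval]
    simp [evalEval]
  · rw [SetLike.mem_coe, ← Ideal.Quotient.eq_zero_iff_mem, CoordinateRing.YClass, hval]
    simp

/-- On an elliptic curve every point is nonsingular, and the ideal of a nonsingular point is
invertible: its product with the ideal of the negated point is principal. -/
instance isDedekindDomain_coordinateRing [IsAlgClosed F] [W.IsElliptic] :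
    IsDedekindDomain W.CoordinateRing := by
  refine isDedekindDomain_of_isMaximal_isUnit fun M hM _ => ?_
  obtain ⟨x, y, h, rfl⟩ := exists_eq_XYIdeal M hM
  exact ⟨CoordinateRing.XYIdeal' ((equation_iff_nonsingular).1 h), rfl⟩

/-- The invertible ideal of a point; that of the origin is the unit ideal. -/
def pointIdeal : W.Point → (FractionalIdeal W.CoordinateRing⁰ W.FunctionField)ˣ
  | .zero => 1
  | .some _ _ h => CoordinateRing.XYIdeal' (W := W) h

theorem toClass_eq_mk_pointIdeal [DecidableEq F] (P : W.Point) :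
    Point.toClass P = Additive.ofMul (ClassGroup.mk W.FunctionField (pointIdeal P)) := by
  cases P with
  | zero => exact (congrArg Additive.ofMul (map_one (ClassGroup.mk W.FunctionField))).symm
  | some x y h => rfl

variable [IsAlgClosed F] [W.IsElliptic]

/-- The prime ideal of an affine point. -/
def pointPrime {x y : F} (h : W.Nonsingular x y) : HeightOneSpectrum W.CoordinateRing where
  asIdeal := CoordinateRing.XYIdeal W x (C y)
  isPrime := (XYIdeal_isMaximal h.1).isPrime
  ne_bot := XYIdeal_ne_bot x (C y)

theorem exists_eq_pointPrime (v : HeightOneSpectrum W.CoordinateRing) :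
    ∃ (x y : F) (h : W.Nonsingular x y), v = pointPrime h := by
  obtain ⟨x, y, h, he⟩ := exists_eq_XYIdeal v.asIdeal v.isMaximal
  exact ⟨x, y, equation_iff_nonsingular.1 h, HeightOneSpectrum.ext he⟩

/-- The order of a function at an affine point. -/
def ordAt {x y : F} (h : W.Nonsingular x y) (ψ : W.FunctionField) : ℤ :=
  count W.FunctionField (pointPrime h) (spanSingleton W.CoordinateRing⁰ ψ)

theorem ordAt_mul {x y : F} (h : W.Nonsingular x y) {φ ψ : W.FunctionField} (hφ : φ ≠ 0)
    (hψ : ψ ≠ 0) : ordAt h (φ * ψ) = ordAt h φ + ordAt h ψ := by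
  rw [ordAt, ← spanSingleton_mul_spanSingleton,
    count_mul _ _ (spanSingleton_ne_zero_iff.2 hφ) (spanSingleton_ne_zero_iff.2 hψ)]
  rfl

/-- Exponents of fractional ideals suit computations with divisors, valuations suit the local ring;
this is the bridge between the two. -/
theorem valuation_algebraMap_eq_exp_ordAt {x y : F} (h : W.Nonsingular x y)
    {r : W.CoordinateRing} (hr : r ≠ 0) :
    (pointPrime h).valuation W.FunctionField (algebraMap _ _ r) =
      WithZero.exp (-ordAt h (algebraMap _ _ r)) := by
  rw [HeightOneSpectrum.valuation_of_algebraMap, HeightOneSpectrum.intValuation_if_neg _ hr, ordAt,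
    ← coeIdeal_span_singleton, count_coe _ _ (by simpa using hr)]

theorem valuation_eq_exp_ordAt {x y : F} (h : W.Nonsingular x y) {ψ : W.FunctionField}
    (hψ : ψ ≠ 0) :
    (pointPrime h).valuation W.FunctionField ψ = WithZero.exp (-ordAt h ψ) := by
  obtain ⟨r, s, hs, rfl⟩ := IsFractionRing.div_surjective (A := W.CoordinateRing) ψ
  have hs0 : algebraMap W.CoordinateRing W.FunctionField s ≠ 0 := by
    simpa using nonZeroDivisors.ne_zero hs
  have hr0 : algebraMap W.CoordinateRing W.FunctionField r ≠ 0 := fun h0 => hψ (by simp [h0])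
  have hmul := ordAt_mul h hψ hs0
  rw [div_mul_cancel₀ _ hs0] at hmul
  rw [map_div₀, valuation_algebraMap_eq_exp_ordAt h (by simpa using hr0),
    valuation_algebraMap_eq_exp_ordAt h (by simpa using hs0), ← WithZero.exp_sub, hmul]
  congr 1
  ring

theorem ordAt_algebraMap_eq_zero {x y : F} (h : W.Nonsingular x y) {r : W.CoordinateRing}
    (hr : r ∉ CoordinateRing.XYIdeal W x (C y)) :
    ordAt h (algebraMap _ W.FunctionField r) = 0 := by
  have hr0 : r ≠ 0 := by rintro rfl; simp at hr
  have h1 := valuation_algebraMap_eq_exp_ordAt h hr0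
  rw [((pointPrime h).valuation_eq_one_iff_notMem (K := W.FunctionField)).2 hr,
    ← WithZero.exp_zero, WithZero.exp_inj] at h1
  omega

/-- A function is, up to a unit of the local ring at a point, the power of a uniformizer at this
point. -/
theorem exists_eq_zpow_ordAt_mul {x y : F} (h : W.Nonsingular x y) {t ψ : W.FunctionField}
    (ht0 : t ≠ 0) (ht : ordAt h t = 1) (hψ : ψ ≠ 0) :
    ∃ r s : W.CoordinateRing, r ∉ CoordinateRing.XYIdeal W x (C y) ∧
      s ∉ CoordinateRing.XYIdeal W x (C y) ∧
      ψ = t ^ ordAt h ψ * (algebraMap _ _ r / algebraMap _ _ s) := by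
  -- Dividing by `t ^ ordAt h ψ` leaves an element of valuation one. It is a fraction with
  -- denominator outside the prime, and then its numerator is outside as well.
  have hv : (pointPrime h).valuation W.FunctionField (ψ / t ^ ordAt h ψ) = 1 := by
    rw [map_div₀, map_zpow₀, valuation_eq_exp_ordAt h hψ, valuation_eq_exp_ordAt h ht0, ht,
      ← WithZero.exp_zsmul, ← WithZero.exp_sub, ← WithZero.exp_zero]
    congr 1
    simp
  obtain ⟨r, s, hrs⟩ := (pointPrime h).exists_primeCompl_mul_eq_of_integer _ hv.le
  have hs : (s : W.CoordinateRing) ∉ CoordinateRing.XYIdeal W x (C y) := s.2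
  have hs0 : algebraMap W.CoordinateRing W.FunctionField s ≠ 0 := by
    have : (s : W.CoordinateRing) ≠ 0 := fun h0 => hs (by rw [h0]; exact zero_mem _)
    simpa using this
  refine ⟨r, s, ?_, hs, ?_⟩
  · refine ((pointPrime h).valuation_eq_one_iff_notMem (K := W.FunctionField)).1 ?_
    rw [← hrs, map_mul, hv, one_mul]
    exact ((pointPrime h).valuation_eq_one_iff_notMem (K := W.FunctionField)).2 hs
  · rw [← hrs, mul_div_cancel_right₀ _ hs0, mul_div_cancel₀ _ (zpow_ne_zero _ ht0)]

variable [DecidableEq F]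

theorem count_pointIdeal {x y : F} (h : W.Nonsingular x y) (P : W.Point) :
    count W.FunctionField (pointPrime h) (pointIdeal P : FractionalIdeal _ W.FunctionField) =
      if P = .some x y h then 1 else 0 := by
  classical
  cases P with
  | zero =>
    rw [if_neg (by simp)]
    exact count_one ..
  | some x' y' h' =>
    have := count_maximal W.FunctionField (pointPrime h) (pointPrime h')
    refine this.trans ?_
    congr 1
    rw [Point.some.injEq, eq_iff_iff]
    constructor
    · intro he
      exact XYIdeal_injective h'.1 (congrArg HeightOneSpectrum.asIdeal he)
    · rintro ⟨rfl, rfl⟩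
      rfl

/-- The vertical line through a point meets the affine curve in this point and its negative: `(X -
x') = I_P I_{-P}`. -/
theorem ordAt_XClass {x y x' y' : F} (h : W.Nonsingular x y) (h' : W.Nonsingular x' y') :
    ordAt h (algebraMap _ W.FunctionField (CoordinateRing.XClass W x')) =
      (if Point.some x' y' h' = .some x y h then 1 else 0) +
        if -Point.some x' y' h' = .some x y h then 1 else 0 := by
  have hI : spanSingleton W.CoordinateRing⁰
      (algebraMap _ W.FunctionField (CoordinateRing.XClass W x')) =
      (pointIdeal (-Point.some x' y' h') : FractionalIdeal _ W.FunctionField) *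
        (pointIdeal (Point.some x' y' h') : FractionalIdeal _ W.FunctionField) := by
    rw [← coeIdeal_span_singleton]
    exact (congrArg _ (CoordinateRing.XYIdeal_neg_mul h').symm).trans (coeIdeal_mul ..)
  rw [ordAt, hI, count_mul _ _ (Units.ne_zero _) (Units.ne_zero _), count_pointIdeal,
    count_pointIdeal, add_comm]

/-- The chord (or tangent) through `P` and `Q`, divided by the vertical line through `P + Q`, is the
function with divisor `(P) + (Q) - (P + Q) - (0)`. Its affine orders are read off from `(X - x₃) I_P
I_Q = (line) I_{P+Q}`. -/
theorem ordAt_line {x y x₁ y₁ x₂ y₂ : F} (h : W.Nonsingular x y) (h₁ : W.Nonsingular x₁ y₁)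
    (h₂ : W.Nonsingular x₂ y₂) (hxy : ¬(x₁ = x₂ ∧ y₁ = W.negY x₂ y₂)) :
    ordAt h (algebraMap _ W.FunctionField
        (CoordinateRing.YClass W (linePolynomial x₁ y₁ (W.slope x₁ x₂ y₁ y₂))) /
      algebraMap _ W.FunctionField
        (CoordinateRing.XClass W (W.addX x₁ x₂ (W.slope x₁ x₂ y₁ y₂)))) =
      (if Point.some x₁ y₁ h₁ = .some x y h then 1 else 0) +
        (if Point.some x₂ y₂ h₂ = .some x y h then 1 else 0) -
        if Point.some x₁ y₁ h₁ + Point.some x₂ y₂ h₂ = .some x y h then 1 else 0 := by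
  set a := algebraMap _ W.FunctionField
    (CoordinateRing.YClass W (linePolynomial x₁ y₁ (W.slope x₁ x₂ y₁ y₂))) with ha
  set b := algebraMap _ W.FunctionField
    (CoordinateRing.XClass W (W.addX x₁ x₂ (W.slope x₁ x₂ y₁ y₂))) with hb
  have ha0 : a ≠ 0 := by simpa [ha] using CoordinateRing.YClass_ne_zero _
  have hb0 : b ≠ 0 := by simpa [hb] using CoordinateRing.XClass_ne_zero _
  have hI : spanSingleton W.CoordinateRing⁰ b *
      ((pointIdeal (Point.some x₁ y₁ h₁) : FractionalIdeal _ W.FunctionField) *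
        (pointIdeal (Point.some x₂ y₂ h₂) : FractionalIdeal _ W.FunctionField)) =
      spanSingleton W.CoordinateRing⁰ a *
        (pointIdeal (Point.some x₁ y₁ h₁ + Point.some x₂ y₂ h₂) :
          FractionalIdeal _ W.FunctionField) := by
    rw [Point.add_some hxy, hb, ha, ← coeIdeal_span_singleton, ← coeIdeal_span_singleton]
    have := congrArg (fun I : Ideal W.CoordinateRing =>
      (I : FractionalIdeal W.CoordinateRing⁰ W.FunctionField))
      (CoordinateRing.XYIdeal_mul_XYIdeal h₁.1 h₂.1 hxy)
    simp only [coeIdeal_mul] at this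
    exact this
  have hc := congrArg (count W.FunctionField (pointPrime h)) hI
  rw [count_mul _ _ (spanSingleton_ne_zero_iff.2 hb0) (Units.ne_zero (_ * _)),
    count_mul _ _ (Units.ne_zero _) (Units.ne_zero _),
    count_mul _ _ (spanSingleton_ne_zero_iff.2 ha0) (Units.ne_zero _), count_pointIdeal,
    count_pointIdeal, count_pointIdeal] at hc
  have hm := ordAt_mul h (div_ne_zero ha0 hb0) hb0
  rw [div_mul_cancel₀ _ hb0] at hm
  change ordAt h b + _ = ordAt h a + _ at hc
  linarith

/-- The points of a principal divisor sum to zero. -/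
theorem sum_smul_eq_zero_of_ordAt (G : W.Point →₀ ℤ) {ψ : W.FunctionField} (hψ : ψ ≠ 0)
    (hG : ∀ (x y : F) (h : W.Nonsingular x y), ordAt h ψ = G (.some x y h)) :
    G.sum (fun P n => n • P) = 0 := by
  -- Both sides have the same exponent at every prime. The coefficient of `G` at the origin is
  -- unconstrained and harmless: the origin has the unit ideal, and it adds nothing to the sum.
  have hU : ((G.prod fun P n => pointIdeal P ^ n :
      (FractionalIdeal W.CoordinateRing⁰ W.FunctionField)ˣ) :
      FractionalIdeal W.CoordinateRing⁰ W.FunctionField) = spanSingleton _ ψ := by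
    refine (finprod_heightOneSpectrum_factorization' W.FunctionField (Units.ne_zero _)).symm.trans
      (Eq.trans (finprod_congr fun v => ?_) (finprod_heightOneSpectrum_factorization'
        W.FunctionField (spanSingleton_ne_zero_iff.2 hψ)))
    obtain ⟨x, y, h, rfl⟩ := exists_eq_pointPrime v
    congr 1
    refine Eq.trans ?_ (hG x y h).symm
    rw [Finsupp.prod, Units.coe_prod, count_prod _ _ _ _ fun _ _ => Units.ne_zero _]
    simp_rw [Units.val_zpow_eq_zpow_val, count_zpow, count_pointIdeal]
    simp only [mul_ite, mul_one, mul_zero, Finset.sum_ite_eq', Finsupp.mem_support_iff]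
    split_ifs with h0
    · rfl
    · exact (not_not.1 h0).symm
  -- The sum of the points has as its class the class of the product of their ideals, which is the
  -- principal ideal of `ψ`.
  apply Point.toClass_injective
  rw [map_zero, Finsupp.sum, map_sum]
  have hmk : ClassGroup.mk W.FunctionField (G.prod fun P n => pointIdeal P ^ n) = 1 := by
    rw [ClassGroup.mk_eq_one_iff, hU, coe_spanSingleton]
    exact ⟨ψ, rfl⟩
  rw [Finsupp.prod, map_prod] at hmk
  have := congrArg Additive.ofMul hmk
  rw [ofMul_prod, ofMul_one] at this
  rw [← this]
  refine Finset.sum_congr rfl fun P _ => ?_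
  rw [map_zsmul, map_zpow, ofMul_zpow, toClass_eq_mk_pointIdeal]

end Weierstrass

variable {p : ℕ} [Fact p.Prime] [Fact (p ≠ 2)] [Fact (p % 3 = 2)]

/-! ### Endomorphisms of the function field -/

theorem transcendental_xFun : Transcendental (Fbar p) (xFun p) := by
  rw [transcendental_iff]
  intro g hg
  by_contra h0
  refine of_ne_zero h0 ?_
  rw [← hg]
  have : ((algebraMap (CoordRing p) (FunctionField p)).comp (AdjoinRoot.of _)) =
      (aeval (xFun p) : (Fbar p)[X] →ₐ[Fbar p] FunctionField p).toRingHom := by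
    refine Polynomial.ringHom_ext (fun c => ?_) ?_
    · simp
      rfl
    · simp [xFun]
  exact RingHom.congr_fun this g

theorem xFun_ne_zero : xFun p ≠ 0 := by simpa using xFun_ne_algebraMap (p := p) 0

/-- The homomorphism from the coordinate ring to an `𝔽̄_p`-algebra that is given by `σ`
on constants and maps `x` and `y` to `u` and `v`. -/
def coordHom {L : Type*} [CommRing L] [Algebra (Fbar p) L] (σ : Fbar p →+* Fbar p) (u v : L)
    (h : v ^ 2 = u ^ 6 + 1) : CoordRing p →+* L :=
  AdjoinRoot.lift (eval₂RingHom ((algebraMap (Fbar p) L).comp σ) u) v (by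
    rw [eval₂_sub, eval₂_pow, eval₂_X, eval₂_C, h]
    simp)

section coordHom

variable {L : Type*} [CommRing L] [Algebra (Fbar p) L] (σ : Fbar p →+* Fbar p) {u v : L}
    (h : v ^ 2 = u ^ 6 + 1)

@[simp]
theorem coordHom_algebraMap (c : Fbar p) :
    coordHom σ u v h (algebraMap (Fbar p) _ c) = algebraMap _ L (σ c) := by
  change coordHom σ u v h (AdjoinRoot.of _ (C c)) = _
  rw [coordHom, AdjoinRoot.lift_of]
  simp

@[simp]
theorem coordHom_x : coordHom σ u v h (AdjoinRoot.of _ X) = u := by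
  rw [coordHom, AdjoinRoot.lift_of]
  simp

@[simp]
theorem coordHom_y : coordHom σ u v h (AdjoinRoot.root _) = v := by
  rw [coordHom, AdjoinRoot.lift_root]

end coordHom

/-- The coordinate ring is a domain integral over the polynomials in `x`, so a nonzero kernel would
contain a nonzero polynomial in `x`. The transcendence of `u` forbids this. -/
theorem coordHom_injective {L : Type*} [Field L] [Algebra (Fbar p) L] (σ : Fbar p →+* Fbar p)
    {u v : L} (h : v ^ 2 = u ^ 6 + 1) (hu : Transcendental (Fbar p) u) :
    Function.Injective (coordHom σ u v h) := by
  rw [RingHom.injective_iff_ker_eq_bot]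
  have hm : (X ^ 2 - C (X ^ 6 + 1) : (Fbar p)[X][X]).Monic := monic_X_pow_sub_C _ two_ne_zero
  have : Module.Finite (Fbar p)[X] (CoordRing p) := hm.finite_adjoinRoot
  refine Ideal.eq_bot_of_comap_eq_bot (R := (Fbar p)[X]) ?_
  rw [eq_bot_iff]
  intro g hg
  rw [Ideal.mem_comap, RingHom.mem_ker] at hg
  have h1 : aeval u (g.map σ) = 0 := by
    rw [aeval_def, eval₂_map]
    change coordHom σ u v h (AdjoinRoot.of _ g) = 0 at hg
    rwa [coordHom, AdjoinRoot.lift_of] at hg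
  have h2 := (transcendental_iff.1 hu) _ h1
  rwa [Polynomial.map_eq_zero] at h2

/-- The homomorphism from the function field of `C` that is given by `σ` on constants and maps `x`
and `y` to `u` and `v`. -/
def fieldHom {L : Type*} [Field L] [Algebra (Fbar p) L] (σ : Fbar p →+* Fbar p) (u v : L)
    (h : v ^ 2 = u ^ 6 + 1) (hu : Transcendental (Fbar p) u) : FunctionField p →+* L :=
  IsFractionRing.lift (coordHom_injective σ h hu)

section fieldHom

variable {L : Type*} [Field L] [Algebra (Fbar p) L] (σ : Fbar p →+* Fbar p) {u v : L}
    (h : v ^ 2 = u ^ 6 + 1) (hu : Transcendental (Fbar p) u)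

@[simp]
theorem fieldHom_algebraMap (c : Fbar p) :
    fieldHom σ u v h hu (algebraMap (Fbar p) _ c) = algebraMap _ L (σ c) := by
  rw [IsScalarTower.algebraMap_apply (Fbar p) (CoordRing p) (FunctionField p), fieldHom,
    IsFractionRing.lift_algebraMap, coordHom_algebraMap]

@[simp]
theorem fieldHom_x : fieldHom σ u v h hu (xFun p) = u := by
  rw [xFun, fieldHom, IsFractionRing.lift_algebraMap, coordHom_x]

@[simp]
theorem fieldHom_y : fieldHom σ u v h hu (yFun p) = v := by
  rw [yFun, fieldHom, IsFractionRing.lift_algebraMap, coordHom_y]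

end fieldHom

theorem chi_relation : (yFun p / xFun p ^ 3) ^ 2 = (xFun p)⁻¹ ^ 6 + 1 := by
  have := xFun_ne_zero (p := p)
  rw [div_pow, yFun_sq]
  field_simp
  ring

variable (p) in
/-- The pull-back of functions by `(x, y) ↦ (1 / x, y / x³)`. -/
def chiField : FunctionField p →+* FunctionField p :=
  fieldHom (RingHom.id _) (xFun p)⁻¹ (yFun p / xFun p ^ 3) chi_relation
    fun h => transcendental_xFun (p := p) (by simpa using h.inv)

/-- The pull-back of functions by `(x, y) ↦ (ζ⁻¹ x, y)`. -/
def rhoField (ζ : Fbar p) (hζ : ζ ^ 6 = 1) : FunctionField p →+* FunctionField p :=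
  fieldHom (RingHom.id _) (algebraMap (Fbar p) _ ζ⁻¹ * xFun p) (yFun p)
    (by rw [mul_pow, ← map_pow, inv_pow, hζ, inv_one, map_one, one_mul, yFun_sq])
    fun h => transcendental_xFun (p := p) (by
      have hζ0 : ζ ≠ 0 := by rintro rfl; norm_num at hζ
      have := (isAlgebraic_algebraMap (R := Fbar p) (A := FunctionField p) ζ).mul h
      rwa [← mul_assoc, ← map_mul, mul_inv_cancel₀ hζ0, map_one, one_mul] at this)

variable (p) in
/-- The action of the Frobenius automorphism of `𝔽̄_p` on the coefficients of functions. -/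
def frobField : FunctionField p →+* FunctionField p :=
  fieldHom (frobenius (Fbar p) p) (xFun p) (yFun p) yFun_sq transcendental_xFun

@[simp]
theorem chiField_algebraMap (c : Fbar p) :
    chiField p (algebraMap (Fbar p) _ c) = algebraMap (Fbar p) _ c :=
  fieldHom_algebraMap ..

@[simp]
theorem chiField_x : chiField p (xFun p) = (xFun p)⁻¹ :=
  fieldHom_x ..

@[simp]
theorem chiField_y : chiField p (yFun p) = yFun p / xFun p ^ 3 :=
  fieldHom_y ..

@[simp]
theorem rhoField_algebraMap {ζ : Fbar p} (hζ : ζ ^ 6 = 1) (c : Fbar p) :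
    rhoField ζ hζ (algebraMap (Fbar p) _ c) = algebraMap (Fbar p) _ c :=
  fieldHom_algebraMap ..

@[simp]
theorem rhoField_x {ζ : Fbar p} (hζ : ζ ^ 6 = 1) :
    rhoField ζ hζ (xFun p) = algebraMap (Fbar p) _ ζ⁻¹ * xFun p :=
  fieldHom_x ..

@[simp]
theorem rhoField_y {ζ : Fbar p} (hζ : ζ ^ 6 = 1) : rhoField ζ hζ (yFun p) = yFun p :=
  fieldHom_y ..

@[simp]
theorem frobField_algebraMap (c : Fbar p) :
    frobField p (algebraMap (Fbar p) _ c) = algebraMap (Fbar p) _ (c ^ p) :=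
  fieldHom_algebraMap ..

@[simp]
theorem frobField_x : frobField p (xFun p) = xFun p :=
  fieldHom_x ..

@[simp]
theorem frobField_y : frobField p (yFun p) = yFun p :=
  fieldHom_y ..

/-! ### Regular functions and their values -/

/-- `u` is regular at `P`, with value `c`. -/
def HasValue (P : CPoint p) (u : FunctionField p) (c : Fbar p) : Prop :=
  ∃ g h : MvPolynomial (Fin 2) (Fbar p), MvPolynomial.eval (chartValue p P) h ≠ 0 ∧
    MvPolynomial.aeval (chart p P) h ≠ 0 ∧
    u = MvPolynomial.aeval (chart p P) g / MvPolynomial.aeval (chart p P) h ∧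
    c = MvPolynomial.eval (chartValue p P) g / MvPolynomial.eval (chartValue p P) h

/-- A relation between `x` and `y` in the function field already holds in the coordinate ring, and
evaluation at `(a, b)` is a homomorphism on that ring. This makes values of functions well defined.
-/
theorem eval_affine_eq_zero {a b : Fbar p} (h : b ^ 2 = a ^ 6 + 1)
    {g : MvPolynomial (Fin 2) (Fbar p)} (hg : MvPolynomial.aeval ![xFun p, yFun p] g = 0) :
    MvPolynomial.eval ![a, b] g = 0 := by
  let x' : CoordRing p := AdjoinRoot.of _ X
  let y' : CoordRing p := AdjoinRoot.root _
  have h1 : algebraMap (CoordRing p) (FunctionField p) (MvPolynomial.aeval ![x', y'] g) = 0 := by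
    rw [← hg, ← MvPolynomial.aeval_algebraMap_apply]
    congr 2
    funext i
    fin_cases i <;> rfl
  have h2 : MvPolynomial.aeval ![x', y'] g = 0 :=
    (FaithfulSMul.algebraMap_eq_zero_iff (CoordRing p) (FunctionField p)).1 h1
  have h3 := congrArg (coordHom (RingHom.id (Fbar p)) a b h) h2
  rw [map_zero, MvPolynomial.aeval_def, MvPolynomial.hom_eval₂] at h3
  rw [← h3, MvPolynomial.eval, MvPolynomial.coe_eval₂Hom]
  congr 1
  · ext c; simp
  · funext i
    fin_cases i <;> simp [x', y']

theorem eval_eq_zero_of_aeval_eq_zero (P : CPoint p) {g : MvPolynomial (Fin 2) (Fbar p)}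
    (hg : MvPolynomial.aeval (chart p P) g = 0) : MvPolynomial.eval (chartValue p P) g = 0 := by
  cases P with
  | affine a b h => exact eval_affine_eq_zero h hg
  | infty s h =>
    -- The involution `χ` exchanges the chart at infinity with the affine chart and takes the point
    -- with `t = 0` to `(0, s)`.
    refine eval_affine_eq_zero (a := 0) (b := s) (by rw [h]; norm_num) ?_
    apply (chiField p).injective
    rw [map_zero, ← hg, MvPolynomial.aeval_def, MvPolynomial.aeval_def, MvPolynomial.hom_eval₂]
    congr 1
    · ext c; simp
    · funext i
      fin_cases i <;> simp [chart]

theorem aeval_ne_zero {P : CPoint p} {g : MvPolynomial (Fin 2) (Fbar p)}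
    (hg : MvPolynomial.eval (chartValue p P) g ≠ 0) : MvPolynomial.aeval (chart p P) g ≠ 0 :=
  fun h => hg (eval_eq_zero_of_aeval_eq_zero P h)

namespace HasValue

variable {P : CPoint p} {u v : FunctionField p} {c d : Fbar p}

theorem aeval (P : CPoint p) (g : MvPolynomial (Fin 2) (Fbar p)) :
    HasValue P (MvPolynomial.aeval (chart p P) g) (MvPolynomial.eval (chartValue p P) g) :=
  ⟨g, 1, by simp, by simp, by simp, by simp⟩

theorem chart (P : CPoint p) (i : Fin 2) : HasValue P (chart p P i) (chartValue p P i) := by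
  simpa using aeval P (MvPolynomial.X i)

theorem const (P : CPoint p) (c : Fbar p) : HasValue P (algebraMap (Fbar p) _ c) c := by
  simpa using aeval P (MvPolynomial.C c)

theorem one (P : CPoint p) : HasValue P 1 1 := by simpa using const P 1

theorem add (hu : HasValue P u c) (hv : HasValue P v d) : HasValue P (u + v) (c + d) := by
  obtain ⟨g, h, hh, hh', rfl, rfl⟩ := hu
  obtain ⟨g', h', hk, hk', rfl, rfl⟩ := hv
  exact ⟨g * h' + h * g', h * h', by simpa using ⟨hh, hk⟩, by simpa using ⟨hh', hk'⟩,
    by simp [div_add_div _ _ hh' hk'], by simp [div_add_div _ _ hh hk]⟩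

theorem mul (hu : HasValue P u c) (hv : HasValue P v d) : HasValue P (u * v) (c * d) := by
  obtain ⟨g, h, hh, hh', rfl, rfl⟩ := hu
  obtain ⟨g', h', hk, hk', rfl, rfl⟩ := hv
  exact ⟨g * g', h * h', by simpa using ⟨hh, hk⟩, by simpa using ⟨hh', hk'⟩,
    by simp [div_mul_div_comm], by simp [div_mul_div_comm]⟩

theorem neg (hu : HasValue P u c) : HasValue P (-u) (-c) := by
  simpa using (const P (-1)).mul hu

theorem sub (hu : HasValue P u c) (hv : HasValue P v d) : HasValue P (u - v) (c - d) := by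
  simpa [sub_eq_add_neg] using hu.add hv.neg

theorem pow (hu : HasValue P u c) (n : ℕ) : HasValue P (u ^ n) (c ^ n) := by
  induction n with
  | zero => simpa using one P
  | succ n ih => simpa [pow_succ] using ih.mul hu

theorem inv (hu : HasValue P u c) (hc : c ≠ 0) : HasValue P u⁻¹ c⁻¹ := by
  obtain ⟨g, h, hh, hh', rfl, rfl⟩ := hu
  have hg : MvPolynomial.eval (chartValue p P) g ≠ 0 := fun h0 => hc (by rw [h0, zero_div])
  exact ⟨h, g, hg, aeval_ne_zero hg, by simp, by simp⟩

theorem div (hu : HasValue P u c) (hv : HasValue P v d) (hd : d ≠ 0) :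
    HasValue P (u / v) (c / d) := by
  simpa [div_eq_mul_inv] using hu.mul (hv.inv hd)

theorem isUnitAt (hu : HasValue P u c) (hc : c ≠ 0) : IsUnitAt P u := by
  obtain ⟨g, h, hh, hh', rfl, rfl⟩ := hu
  exact ⟨g, h, fun h0 => hc (by rw [h0, zero_div]), hh, rfl⟩

theorem unique (hu : HasValue P u c) (hv : HasValue P u d) : c = d := by
  have h0 := hu.sub hv
  rw [sub_self] at h0
  obtain ⟨g, h, hh, hh', he, he'⟩ := h0
  rw [eq_comm, div_eq_zero_iff, or_iff_left hh'] at he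
  rw [eval_eq_zero_of_aeval_eq_zero P he, zero_div] at he'
  exact sub_eq_zero.1 he'

/-- The image of a polynomial expression under a semilinear homomorphism `f`. -/
theorem map_aeval {P Q : CPoint p} {f : FunctionField p →+* FunctionField p}
    {σ : Fbar p →+* Fbar p} (hσ : ∀ c, f (algebraMap (Fbar p) _ c) = algebraMap _ _ (σ c))
    (hf : ∀ i, HasValue Q (f (SexticJacobian.chart p P i)) (σ (chartValue p P i)))
    (g : MvPolynomial (Fin 2) (Fbar p)) :
    HasValue Q (f (MvPolynomial.aeval (SexticJacobian.chart p P) g))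
      (σ (MvPolynomial.eval (chartValue p P) g)) := by
  induction g using MvPolynomial.induction_on with
  | C c => simpa [hσ] using const Q (σ c)
  | add g h hg hh => simpa using hg.add hh
  | mul_X g i hg => simpa using hg.mul (hf i)

end HasValue

theorem IsUnitAt.exists_hasValue {P : CPoint p} {u : FunctionField p} (hu : IsUnitAt P u) :
    ∃ c ≠ 0, HasValue P u c := by
  obtain ⟨g, h, hg, hh, rfl⟩ := hu
  exact ⟨_, div_ne_zero hg hh, g, h, hh, aeval_ne_zero hh, rfl, rfl⟩

theorem IsUnitAt.ne_zero {P : CPoint p} {u : FunctionField p} (hu : IsUnitAt P u) : u ≠ 0 := by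
  obtain ⟨g, h, hg, hh, rfl⟩ := hu
  exact div_ne_zero (aeval_ne_zero hg) (aeval_ne_zero hh)

theorem IsUnitAt.zpow {P : CPoint p} {u : FunctionField p} (hu : IsUnitAt P u) (n : ℤ) :
    IsUnitAt P (u ^ n) := by
  have hpow : ∀ n : ℕ, IsUnitAt P (u ^ n) := by
    intro n
    induction n with
    | zero => simpa using IsUnitAt.one P
    | succ n ih => simpa [pow_succ] using ih.mul hu
  cases n with
  | ofNat n => simpa using hpow n
  | negSucc n => simpa using (hpow (n + 1)).inv

theorem IsUnitAt.map {P Q : CPoint p} {f : FunctionField p →+* FunctionField p}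
    {σ : Fbar p →+* Fbar p} (hσ : ∀ c, f (algebraMap (Fbar p) _ c) = algebraMap _ _ (σ c))
    (hf : ∀ i, HasValue Q (f (chart p P i)) (σ (chartValue p P i))) {u : FunctionField p}
    (hu : IsUnitAt P u) : IsUnitAt Q (f u) := by
  obtain ⟨g, h, hg, hh, rfl⟩ := hu
  rw [map_div₀]
  refine ((HasValue.map_aeval hσ hf g).div (HasValue.map_aeval hσ hf h) ?_).isUnitAt ?_
  · simpa using hh
  · simpa using ⟨hg, hh⟩

/-! ### Orders of functions -/

theorem hasValue_uniformizer (P : CPoint p) : HasValue P (uniformizer P) 0 := by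
  cases P with
  | affine a b h =>
    rw [uniformizer]
    split_ifs with hb
    · simpa [chart, chartValue, hb] using HasValue.chart (.affine a b h) 1
    · simpa [chart, chartValue] using
        (HasValue.chart (.affine a b h) 0).sub (HasValue.const (.affine a b h) a)
  | infty s h => exact HasValue.chart (.infty s h) 0

namespace HasOrd

variable {P : CPoint p} {φ ψ : FunctionField p} {m n : ℤ}

theorem of_isUnitAt (h : IsUnitAt P φ) : HasOrd P φ 0 := ⟨φ, h, by simp⟩

theorem uniformizer (P : CPoint p) : HasOrd P (uniformizer P) 1 := ⟨1, IsUnitAt.one P, by simp⟩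

theorem mul (hφ : HasOrd P φ m) (hψ : HasOrd P ψ n) : HasOrd P (φ * ψ) (m + n) := by
  obtain ⟨u, hu, rfl⟩ := hφ
  obtain ⟨v, hv, rfl⟩ := hψ
  refine ⟨u * v, hu.mul hv, ?_⟩
  rw [zpow_add₀ (uniformizer_ne_zero P)]
  ring

theorem zpow (hφ : HasOrd P φ m) (n : ℤ) : HasOrd P (φ ^ n) (n * m) := by
  obtain ⟨u, hu, rfl⟩ := hφ
  exact ⟨u ^ n, hu.zpow n, by rw [mul_zpow, ← zpow_mul, mul_comm m]⟩

theorem inv (hφ : HasOrd P φ m) : HasOrd P φ⁻¹ (-m) := by simpa using hφ.zpow (-1)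

theorem div (hφ : HasOrd P φ m) (hψ : HasOrd P ψ n) : HasOrd P (φ / ψ) (m - n) := by
  simpa [div_eq_mul_inv, sub_eq_add_neg] using hφ.mul hψ.inv

/-- If `m < n`, then `u = t ^ k * v` with `k > 0` and `u`, `v` units. The right side has value zero
at `P`, the left side does not. -/
theorem le (hφ : HasOrd P φ m) (hφ' : HasOrd P φ n) : n ≤ m := by
  obtain ⟨u, hu, rfl⟩ := hφ
  obtain ⟨v, hv, he⟩ := hφ'
  by_contra! hlt
  obtain ⟨k, hk⟩ := Int.eq_ofNat_of_zero_le (sub_nonneg.2 hlt.le)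
  have hk0 : k ≠ 0 := by omega
  have ht := uniformizer_ne_zero P
  have h1 : u = SexticJacobian.uniformizer P ^ k * v := by
    have h2 : n = m + k := by omega
    rw [h2, zpow_add₀ ht, mul_assoc, zpow_natCast] at he
    exact mul_left_cancel₀ (zpow_ne_zero _ ht) he
  obtain ⟨c, hc, huc⟩ := hu.exists_hasValue
  obtain ⟨d, hd, hvd⟩ := hv.exists_hasValue
  have h2 := ((hasValue_uniformizer P).pow k).mul hvd
  rw [← h1] at h2
  exact hc (by rw [huc.unique h2, zero_pow hk0, zero_mul])

theorem unique (hφ : HasOrd P φ m) (hφ' : HasOrd P φ n) : m = n :=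
  le_antisymm (hφ'.le hφ) (hφ.le hφ')

/-- Transport of orders from `P` to `Q` reduces to two checks: the images of the chart coordinates
have the right values at `Q`, and the image of the uniformizer has order one there. -/
theorem map {P Q : CPoint p} {f : FunctionField p →+* FunctionField p}
    {σ : Fbar p →+* Fbar p} (hσ : ∀ c, f (algebraMap (Fbar p) _ c) = algebraMap _ _ (σ c))
    (hf : ∀ i, HasValue Q (f (chart p P i)) (σ (chartValue p P i)))
    (ht : HasOrd Q (f (SexticJacobian.uniformizer P)) 1) (hφ : HasOrd P φ n) :
    HasOrd Q (f φ) n := by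
  obtain ⟨u, hu, rfl⟩ := hφ
  rw [map_mul, map_zpow₀]
  simpa using (ht.zpow n).mul (of_isUnitAt (hu.map hσ hf))

end HasOrd

/-! ### The action of the automorphisms of `C` on orders and principal divisors -/

section

variable {a b : Fbar p} (h : b ^ 2 = a ^ 6 + 1)

theorem hasValue_x : HasValue (.affine a b h) (xFun p) a :=
  HasValue.chart (.affine a b h) 0

theorem hasValue_y : HasValue (.affine a b h) (yFun p) b :=
  HasValue.chart (.affine a b h) 1

theorem hasOrd_y (hb : b = 0) : HasOrd (.affine a b h) (yFun p) 1 := by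
  simpa [uniformizer, hb] using HasOrd.uniformizer (.affine a b h)

theorem hasOrd_x_sub (hb : b ≠ 0) :
    HasOrd (.affine a b h) (xFun p - algebraMap (Fbar p) _ a) 1 := by
  simpa [uniformizer, hb] using HasOrd.uniformizer (.affine a b h)

variable {s : Fbar p} (hs : s ^ 2 = 1)

theorem hasValue_infty_x : HasValue (.infty s hs) (xFun p)⁻¹ 0 :=
  HasValue.chart (.infty s hs) 0

theorem hasValue_infty_y : HasValue (.infty s hs) (yFun p / xFun p ^ 3) s :=
  HasValue.chart (.infty s hs) 1

theorem hasOrd_infty_x : HasOrd (.infty s hs) (xFun p) (-1) := by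
  simpa [uniformizer] using (HasOrd.uniformizer (.infty s hs)).inv

theorem ne_zero_of_sq_eq_one (hs : s ^ 2 = 1) : s ≠ 0 := by
  rintro rfl
  norm_num at hs

theorem ne_zero_of_pow_six (hs : s ^ 6 = 1) : s ≠ 0 := by
  rintro rfl
  norm_num at hs

end

theorem hasOrd_chi {P : CPoint p} {φ : FunctionField p} {n : ℤ} (hφ : HasOrd P φ n) :
    HasOrd (chiC p P) (chiField p φ) n := by
  have hx0 := xFun_ne_zero (p := p)
  refine HasOrd.map (σ := RingHom.id _) (by simp) ?_ ?_ hφ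
  · cases P with
    | affine a b h =>
      rw [chiC]
      split_ifs with ha
      · subst ha
        intro i
        fin_cases i
        · simpa [chart, chartValue] using hasValue_infty_x (p := p) _
        · simpa [chart, chartValue] using hasValue_infty_y (p := p) _
      · have h' : (b / a ^ 3) ^ 2 = (1 / a) ^ 6 + 1 := by rw [div_pow, h]; field_simp; ring
        intro i
        fin_cases i
        · simpa [chart, chartValue] using (hasValue_x h').inv (by simpa using ha)
        · have := (hasValue_y h').div ((hasValue_x h').pow 3) (by simpa using ha)
          simpa [chart, chartValue, ha] using this
    | infty s h =>
      intro i
      have h' : s ^ 2 = 0 ^ 6 + 1 := by rw [h]; norm_num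
      fin_cases i
      · simpa [chiC, chart, chartValue] using hasValue_x h'
      · have : yFun p / xFun p ^ 3 * xFun p ^ 3 = yFun p := by field_simp
        simpa [chiC, chart, chartValue, this] using hasValue_y h'
  · cases P with
    | affine a b h =>
      rw [chiC]
      split_ifs with ha
      · have hb : b ≠ 0 := by
          rintro rfl
          rw [ha] at h
          norm_num at h
        subst ha
        simpa [uniformizer, hb] using (hasOrd_infty_x (p := p) _).inv
      · have h' : (b / a ^ 3) ^ 2 = (1 / a) ^ 6 + 1 := by rw [div_pow, h]; field_simp; ring
        have hx := hasValue_x h'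
        have hux : IsUnitAt (.affine _ _ h') (xFun p) := hx.isUnitAt (by simpa using ha)
        by_cases hb : b = 0
        · have := (hasOrd_y h' (by simp [hb])).mul
            (HasOrd.of_isUnitAt ((hx.pow 3).isUnitAt (by simpa using ha))).inv
          simpa [uniformizer, hb, div_eq_mul_inv] using this
        · have h1 : chiField p (uniformizer (.affine a b h)) =
              (xFun p - algebraMap (Fbar p) _ (1 / a)) *
                (algebraMap (Fbar p) _ (-a) * (xFun p)⁻¹) := by
            have ha' : algebraMap (Fbar p) (FunctionField p) a ≠ 0 := by simpa using ha
            simp only [uniformizer, hb, if_false, map_sub, chiField_x, chiField_algebraMap,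
              map_div₀, map_one, map_neg]
            field_simp
            ring
          rw [h1]
          refine (hasOrd_x_sub h' (by simp [hb, ha])).mul (HasOrd.of_isUnitAt ?_)
          exact ((HasValue.const _ (-a)).isUnitAt (by simpa using ha)).mul hux.inv
    | infty s h =>
      have h' : s ^ 2 = 0 ^ 6 + 1 := by rw [h]; norm_num
      have := hasOrd_x_sub h' (ne_zero_of_sq_eq_one h)
      simpa [uniformizer, chiC] using this

/-- The field map substitutes `ζ⁻¹ x`, so it composes functions with the inverse of `rhoC`; a zero
at `P` moves to `rhoC P`. -/
theorem hasOrd_rho {ζ : Fbar p} (hζ : ζ ^ 6 = 1) {P : CPoint p} {φ : FunctionField p} {n : ℤ}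
    (hφ : HasOrd P φ n) : HasOrd (rhoC ζ hζ P) (rhoField ζ hζ φ) n := by
  have hx0 := xFun_ne_zero (p := p)
  have hζ0 := ne_zero_of_pow_six hζ
  have hζ' : algebraMap (Fbar p) (FunctionField p) ζ ≠ 0 := by simpa using hζ0
  refine HasOrd.map (σ := RingHom.id _) (by simp) ?_ ?_ hφ
  · cases P with
    | affine a b h =>
      have h' : b ^ 2 = (ζ * a) ^ 6 + 1 := by rw [mul_pow, hζ, one_mul, h]
      intro i
      fin_cases i
      · have := (HasValue.const _ ζ⁻¹).mul (hasValue_x h')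
        rw [inv_mul_cancel_left₀ hζ0] at this
        simpa [rhoC, chart, chartValue] using this
      · simpa [rhoC, chart, chartValue] using hasValue_y h'
    | infty s h =>
      have h' : (s / ζ ^ 3) ^ 2 = 1 := by rw [div_pow, h, ← pow_mul, hζ, div_one]
      intro i
      fin_cases i
      · simpa [rhoC, chart, chartValue, mul_comm] using
          (HasValue.const _ ζ).mul (hasValue_infty_x h')
      · have h1 := (HasValue.const _ (ζ ^ 3)).mul (hasValue_infty_y h')
        rw [mul_div_cancel₀ _ (pow_ne_zero 3 hζ0)] at h1
        have h2 : rhoField ζ hζ (yFun p / xFun p ^ 3) =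
            algebraMap (Fbar p) _ (ζ ^ 3) * (yFun p / xFun p ^ 3) := by
          simp only [map_div₀, map_pow, rhoField_x, rhoField_y, map_inv₀]
          field_simp
        simpa [rhoC, chart, chartValue, h2] using h1
  · cases P with
    | affine a b h =>
      have h' : b ^ 2 = (ζ * a) ^ 6 + 1 := by rw [mul_pow, hζ, one_mul, h]
      by_cases hb : b = 0
      · simpa [rhoC, uniformizer, hb] using hasOrd_y h' hb
      · have h1 : rhoField ζ hζ (uniformizer (.affine a b h)) =
            (xFun p - algebraMap (Fbar p) _ (ζ * a)) * algebraMap (Fbar p) _ ζ⁻¹ := by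
          simp only [uniformizer, hb, if_false, map_sub, rhoField_x, rhoField_algebraMap,
            map_inv₀, map_mul]
          field_simp
        rw [h1]
        exact (hasOrd_x_sub h' hb).mul
          (HasOrd.of_isUnitAt ((HasValue.const _ ζ⁻¹).isUnitAt (inv_ne_zero hζ0)))
    | infty s h =>
      have h' : (s / ζ ^ 3) ^ 2 = 1 := by rw [div_pow, h, ← pow_mul, hζ, div_one]
      have := (HasOrd.of_isUnitAt ((HasValue.const _ ζ).isUnitAt hζ0)).mul
        (hasOrd_infty_x h').inv
      simpa [rhoC, uniformizer, mul_comm] using this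

/-- Composition with Frobenius would multiply orders by `p`. Twisting only the coefficients takes `x
- a` to `x - a ^ p`, so it moves a zero at `P` to `frobC P` with the same order. -/
theorem hasOrd_frob {P : CPoint p} {φ : FunctionField p} {n : ℤ} (hφ : HasOrd P φ n) :
    HasOrd (frobC p P) (frobField p φ) n := by
  have hp : p ≠ 0 := (Fact.out : p.Prime).ne_zero
  refine HasOrd.map (σ := frobenius (Fbar p) p) (by simp [frobenius_def]) ?_ ?_ hφ
  · cases P with
    | affine a b h =>
      intro i
      fin_cases i
      · simpa [frobC, chart, chartValue, frobenius_def] using hasValue_x _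
      · simpa [frobC, chart, chartValue, frobenius_def] using hasValue_y _
    | infty s h =>
      intro i
      fin_cases i
      · simpa [frobC, chart, chartValue, frobenius_def, hp] using hasValue_infty_x _
      · simpa [frobC, chart, chartValue, frobenius_def] using hasValue_infty_y _
  · cases P with
    | affine a b h =>
      by_cases hb : b = 0
      · have h' : (b ^ p) ^ 2 = (a ^ p) ^ 6 + 1 := by
          rw [← pow_mul, mul_comm p 2, pow_mul, h, add_pow_char, one_pow, ← pow_mul, ← pow_mul,
            mul_comm 6 p]
        simpa [frobC, uniformizer, hb] using hasOrd_y h' (by simp [hb, hp])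
      · simpa [frobC, uniformizer, hb] using hasOrd_x_sub (a := a ^ p) (b := b ^ p) _ (by simp [hb])
    | infty s h =>
      simpa [frobC, uniformizer] using (hasOrd_infty_x (s := s ^ p) _).inv

/-- The push-forward of `div φ` is `div (f φ)`. Surjectivity of `α` reaches every point, and
injectivity keeps coefficients from being merged. -/
theorem mapDomain_mem_principal {α : CPoint p → CPoint p} (hα : Function.Bijective α)
    {f : FunctionField p →+* FunctionField p}
    (hf : ∀ {P φ n}, HasOrd P φ n → HasOrd (α P) (f φ) n) {D : Divisor p}
    (hD : D ∈ Principal p) : D.mapDomain α ∈ Principal p := by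
  obtain ⟨φ, hφ, h⟩ := hD
  refine ⟨f φ, (map_ne_zero f).2 hφ, fun Q => ?_⟩
  obtain ⟨P, rfl⟩ := hα.2 Q
  rw [Finsupp.mapDomain_apply hα.1]
  exact hf (h P)

theorem chiC_chiC (P : CPoint p) : chiC p (chiC p P) = P := by
  cases P with
  | affine a b h =>
    by_cases ha : a = 0
    · simp [chiC, ha]
    · simp [chiC, ha]
  | infty s h => simp [chiC]

theorem chiC_bijective : Function.Bijective (chiC p) :=
  Function.Involutive.bijective chiC_chiC

theorem rhoC_bijective {ζ : Fbar p} (hζ : ζ ^ 6 = 1) : Function.Bijective (rhoC ζ hζ) := by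
  have hζ0 := ne_zero_of_pow_six hζ
  constructor
  · rintro (⟨a, b, h⟩ | ⟨s, h⟩) (⟨a', b', h'⟩ | ⟨s', h'⟩) he <;>
      simp [rhoC, hζ0] at he ⊢ <;> exact he
  · rintro (⟨a, b, h⟩ | ⟨s, h⟩)
    · refine ⟨.affine (ζ⁻¹ * a) b (by rw [mul_pow, inv_pow, hζ, inv_one, one_mul, h]), ?_⟩
      simp [rhoC, hζ0]
    · refine ⟨.infty (s * ζ ^ 3) (by rw [mul_pow, h, ← pow_mul, hζ, one_mul]), ?_⟩
      simp [rhoC, hζ0]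

theorem frobC_bijective : Function.Bijective (frobC p) := by
  have hi : Function.Injective (fun a : Fbar p => a ^ p) := frobenius_inj (Fbar p) p
  constructor
  · rintro (⟨a, b, h⟩ | ⟨s, h⟩) (⟨a', b', h'⟩ | ⟨s', h'⟩) he <;> simp [frobC] at he ⊢
    · exact ⟨hi he.1, hi he.2⟩
    · exact hi he
  · have hs : ∀ a : Fbar p, ∃ b, b ^ p = a := fun a =>
      IsAlgClosed.exists_pow_nat_eq a (Fact.out : p.Prime).pos
    rintro (⟨a, b, h⟩ | ⟨s, h⟩)
    · obtain ⟨a, rfl⟩ := hs a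
      obtain ⟨b, rfl⟩ := hs b
      refine ⟨.affine a b (hi ?_), rfl⟩
      simp only [add_pow_char, one_pow]
      rw [← pow_mul, mul_comm, pow_mul, h]
      ring
    · obtain ⟨s, rfl⟩ := hs s
      refine ⟨.infty s (hi ?_), rfl⟩
      simp only [one_pow]
      rw [← pow_mul, mul_comm, pow_mul, h]

theorem mapDomain_chi_mem_principal {D : Divisor p} (hD : D ∈ Principal p) :
    D.mapDomain (chiC p) ∈ Principal p :=
  mapDomain_mem_principal chiC_bijective hasOrd_chi hD

theorem mapDomain_rho_mem_principal {ζ : Fbar p} (hζ : ζ ^ 6 = 1) {D : Divisor p}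
    (hD : D ∈ Principal p) : D.mapDomain (rhoC ζ hζ) ∈ Principal p :=
  mapDomain_mem_principal (rhoC_bijective hζ) (hasOrd_rho hζ) hD

theorem mapDomain_frob_mem_principal {D : Divisor p} (hD : D ∈ Principal p) :
    D.mapDomain (frobC p) ∈ Principal p :=
  mapDomain_mem_principal frobC_bijective hasOrd_frob hD

/-! ### Induced homomorphisms on divisor classes. -/

theorem induced_mk {G : Type*} [AddCommGroup G] {F : DivisorZero p →+ G}
    (h : (Principal p).addSubgroupOf (DivisorZero p) ≤ F.ker) (D : DivisorZero p) :
    induced F (QuotientAddGroup.mk D) = F D := by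
  rw [induced, dif_pos h]
  rfl

theorem inducedEnd_mk {α : CPoint p → CPoint p}
    (h : ∀ D ∈ Principal p, D.mapDomain α ∈ Principal p) (D : DivisorZero p) :
    inducedEnd α (QuotientAddGroup.mk D) = QuotientAddGroup.mk (pushDivisor α D) := by
  refine induced_mk ?_ D
  intro D hD
  rw [AddMonoidHom.mem_ker]
  exact (QuotientAddGroup.eq_zero_iff _).2 (h _ hD)

/-! ### The curve `E` over the algebraic closure. -/

open WeierstrassCurve.Affine (CoordinateRing Point)

variable (p) in
/-- The curve `E` over `𝔽̄_p`. -/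
abbrev EBar : WeierstrassCurve.Affine (Fbar p) := ((E p).baseChange (Fbar p)).toAffine

instance isElliptic_EBar : WeierstrassCurve.IsElliptic (EBar p) := by
  constructor
  have h : WeierstrassCurve.Δ (EBar p) = -(2 ^ 4 * 3 ^ 3) := by
    simp [E, WeierstrassCurve.baseChange, WeierstrassCurve.map, WeierstrassCurve.Δ,
      WeierstrassCurve.b₂, WeierstrassCurve.b₄, WeierstrassCurve.b₆, WeierstrassCurve.b₈]
    norm_num
  rw [h, isUnit_iff_ne_zero]
  exact neg_ne_zero.2 (mul_ne_zero (pow_ne_zero _ (two_ne_zero_Fbar p))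
    (pow_ne_zero _ (three_ne_zero_Fbar p)))

@[simp]
theorem EBar_negY (x y : Fbar p) : (EBar p).negY x y = -y := by
  simp [E, WeierstrassCurve.baseChange, WeierstrassCurve.map, WeierstrassCurve.Affine.negY]

theorem EBar_polynomial : (EBar p).polynomial = X ^ 2 - C (X ^ 3 + 1) := by
  simp [WeierstrassCurve.Affine.polynomial, E, WeierstrassCurve.baseChange, WeierstrassCurve.map]

/-! ### Pull-back of functions by `f` -/

variable (p) in
/-- The homomorphism of coordinate rings given by `f`. -/
def fRing : (EBar p).CoordinateRing →+* CoordRing p :=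
  AdjoinRoot.lift (eval₂RingHom (algebraMap (Fbar p) _) (AdjoinRoot.of _ X ^ 2))
    (AdjoinRoot.root _) (by
      have h := AdjoinRoot.eval₂_root (X ^ 2 - C (X ^ 6 + 1) : (Fbar p)[X][X])
      rw [eval₂_sub, eval₂_pow, eval₂_X, eval₂_C] at h
      rw [EBar_polynomial, eval₂_sub, eval₂_pow, eval₂_X, eval₂_C, ← h]
      simp [← pow_mul])

@[simp]
theorem fRing_X : fRing p (CoordinateRing.mk _ (C X)) = AdjoinRoot.of _ X ^ 2 := by
  rw [fRing, CoordinateRing.mk, AdjoinRoot.lift_mk]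
  simp

@[simp]
theorem fRing_Y : fRing p (CoordinateRing.mk _ X) = AdjoinRoot.root _ := by
  rw [fRing, CoordinateRing.mk, AdjoinRoot.lift_mk]
  simp

@[simp]
theorem fRing_C (c : Fbar p) :
    fRing p (CoordinateRing.mk _ (C (C c))) = algebraMap (Fbar p) _ c := by
  rw [fRing, CoordinateRing.mk, AdjoinRoot.lift_mk]
  simp

theorem transcendental_xFun_sq : Transcendental (Fbar p) (xFun p ^ 2) := fun h =>
  transcendental_xFun (p := p) (h.of_pow two_pos)

/-- As for `coordHom_injective`: by integrality over the polynomials in `X`, it suffices that the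
image `x²` of `X` is transcendental. -/
theorem fRing_algebraMap_injective :
    Function.Injective ((algebraMap (CoordRing p) (FunctionField p)).comp (fRing p)) := by
  have : Module.Finite (Fbar p)[X] (EBar p).CoordinateRing :=
    Module.Finite.of_basis (CoordinateRing.basis (EBar p))
  rw [RingHom.injective_iff_ker_eq_bot]
  refine Ideal.eq_bot_of_comap_eq_bot (R := (Fbar p)[X]) ?_
  rw [eq_bot_iff]
  intro g hg
  rw [Ideal.mem_comap, RingHom.mem_ker] at hg
  refine (transcendental_iff.1 (transcendental_xFun_sq (p := p))) _ ?_
  rw [← hg]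
  have : (aeval (xFun p ^ 2) : (Fbar p)[X] →ₐ[Fbar p] FunctionField p).toRingHom =
      ((algebraMap (CoordRing p) (FunctionField p)).comp (fRing p)).comp
        (algebraMap (Fbar p)[X] (EBar p).CoordinateRing) := by
    refine Polynomial.ringHom_ext (fun c => ?_) ?_
    · have := fRing_C (p := p) c
      change _ = algebraMap _ _ (fRing p (CoordinateRing.mk _ (C (C c))))
      rw [this]
      simp
      rfl
    · change _ = algebraMap _ _ (fRing p (CoordinateRing.mk _ (C X)))
      rw [fRing_X]
      simp [xFun]
  exact RingHom.congr_fun this g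

variable (p) in
/-- The pull-back of functions by `f`. -/
def fField : (EBar p).FunctionField →+* FunctionField p :=
  IsFractionRing.lift fRing_algebraMap_injective

theorem fField_algebraMap (r : (EBar p).CoordinateRing) :
    fField p (algebraMap _ _ r) = algebraMap _ _ (fRing p r) :=
  IsFractionRing.lift_algebraMap ..

@[simp]
theorem fField_XClass (c : Fbar p) :
    fField p (algebraMap _ _ (CoordinateRing.XClass (EBar p) c)) =
      xFun p ^ 2 - algebraMap (Fbar p) _ c := by
  rw [fField_algebraMap, CoordinateRing.XClass, C_sub, map_sub, map_sub, fRing_X, fRing_C]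
  simp [xFun]
  rfl

@[simp]
theorem fField_Y : fField p (algebraMap _ _ (CoordinateRing.mk (EBar p) X)) = yFun p := by
  rw [fField_algebraMap, fRing_Y]
  rfl

theorem fField_line (c d e : Fbar p) :
    fField p (algebraMap _ _ (CoordinateRing.YClass (EBar p)
      (WeierstrassCurve.Affine.linePolynomial c d e))) =
      yFun p - (algebraMap (Fbar p) _ e * (xFun p ^ 2 - algebraMap (Fbar p) _ c) +
        algebraMap (Fbar p) _ d) := by
  rw [fField_algebraMap, CoordinateRing.YClass, WeierstrassCurve.Affine.linePolynomial]
  simp only [map_sub, map_add, map_mul, fRing_X, fRing_C, fRing_Y, map_pow]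
  rfl

/-! ### Orders of pulled back functions -/

theorem coordRing_induction {motive : CoordRing p → Prop}
    (const : ∀ c, motive (algebraMap (Fbar p) _ c))
    (add : ∀ r s, motive r → motive s → motive (r + s))
    (mul_x : ∀ r, motive r → motive (r * AdjoinRoot.of _ X))
    (mul_y : ∀ r, motive r → motive (r * AdjoinRoot.root _)) (r : CoordRing p) : motive r := by
  induction r using AdjoinRoot.induction_on with
  | ih g =>
    induction g using Polynomial.induction_on with
    | C g =>
      induction g using Polynomial.induction_on with
      | C c => exact const c
      | add g g' hg hg' => simpa using add _ _ hg hg'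
      | monomial n c hn => simpa [pow_succ, ← mul_assoc] using mul_x _ hn
    | add g g' hg hg' => simpa using add _ _ hg hg'
    | monomial n c hn => simpa [pow_succ, ← mul_assoc] using mul_y _ hn

/-- A function in the coordinate ring is regular at the affine points. -/
theorem hasValue_algebraMap {a b : Fbar p} (h : b ^ 2 = a ^ 6 + 1) (r : CoordRing p) :
    HasValue (.affine a b h) (algebraMap _ _ r) (coordHom (RingHom.id _) a b h r) := by
  induction r using coordRing_induction with
  | const c =>
    rw [coordHom_algebraMap]
    exact HasValue.const (.affine a b h) c
  | add r s hr hs => simpa using hr.add hs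
  | mul_x r hr => simpa [xFun] using hr.mul (hasValue_x h)
  | mul_y r hr => simpa [yFun] using hr.mul (hasValue_y h)

/-- Pulling back to `C` and evaluating at `(a, b)` is a homomorphism whose kernel is the maximal
ideal of the image point. An element outside that ideal therefore has a nonzero value. -/
theorem isUnitAt_fRing {a b : Fbar p} (h : b ^ 2 = a ^ 6 + 1) {r : (EBar p).CoordinateRing}
    (hr : r ∉ CoordinateRing.XYIdeal _ (a ^ 2) (C b)) :
    IsUnitAt (.affine a b h) (algebraMap _ _ (fRing p r)) := by
  refine (hasValue_algebraMap h (fRing p r)).isUnitAt fun h0 => hr ?_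
  have hE : (EBar p).Equation (a ^ 2) b := (E_equation_iff _ _).2 (by rw [h]; ring)
  let e : (EBar p).CoordinateRing →+* Fbar p := (coordHom (RingHom.id _) a b h).comp (fRing p)
  have hle : CoordinateRing.XYIdeal (EBar p) (a ^ 2) (C b) ≤ RingHom.ker e := by
    rw [CoordinateRing.XYIdeal, Ideal.span_le]
    rintro r (rfl | rfl)
    · rw [SetLike.mem_coe, RingHom.mem_ker, RingHom.comp_apply, CoordinateRing.XClass, C_sub,
        map_sub, map_sub, fRing_X, fRing_C]
      simp
    · rw [SetLike.mem_coe, RingHom.mem_ker, RingHom.comp_apply, CoordinateRing.YClass,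
        map_sub, map_sub, fRing_Y, fRing_C]
      simp
  rw [(XYIdeal_isMaximal hE).eq_of_le (RingHom.ker_ne_top e) hle]
  exact h0

/-! ### The involution `ι`, the fibres of `f`, and the pull-back divisors. -/

variable (p) in
/-- The involution `(x, y) ↦ (-x, y)` of `C`. -/
def iota : CPoint p → CPoint p := rhoC (-1) (by norm_num)

theorem iota_affine {a b : Fbar p} (h : b ^ 2 = a ^ 6 + 1) :
    iota p (.affine a b h) = .affine (-a) b (by rw [h]; ring) := by
  simp [iota, rhoC]

theorem iota_infty {s : Fbar p} (h : s ^ 2 = 1) :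
    iota p (.infty s h) = .infty (-s) (by rw [neg_sq, h]) := by
  simp only [iota, rhoC, CPoint.infty.injEq]
  rw [Odd.neg_one_pow (by decide), div_neg, div_one]

theorem iota_iota (P : CPoint p) : iota p (iota p P) = P := by
  cases P with
  | affine a b h => simp [iota_affine]
  | infty s h => simp [iota_infty]

theorem fMap_iota (P : CPoint p) : fMap p (iota p P) = fMap p P := by
  cases P with
  | affine a b h => simp [iota_affine, fMap, ePoint]
  | infty s h => simp [iota_infty, fMap]

theorem fMap_eq_fMap_iff {P Q : CPoint p} : fMap p P = fMap p Q ↔ P = Q ∨ P = iota p Q := by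
  refine ⟨fun h => ?_, ?_⟩
  · cases P with
    | affine a b hP =>
      cases Q with
      | affine a' b' hQ =>
        simp only [fMap, ePoint, Point.some.injEq, iota_affine, CPoint.affine.injEq] at h ⊢
        rcases sq_eq_sq_iff_eq_or_eq_neg.1 h.1 with h1 | h1
        · exact Or.inl ⟨h1, h.2⟩
        · exact Or.inr ⟨h1, h.2⟩
      | infty s hQ => exact absurd h (by simp [fMap, ePoint])
    | infty s hP =>
      cases Q with
      | affine a' b' hQ => exact absurd h.symm (by simp [fMap, ePoint])
      | infty s' hQ =>
        simp only [iota_infty, CPoint.infty.injEq]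
        exact sq_eq_sq_iff_eq_or_eq_neg.1 (hP.trans hQ.symm)
  · rintro (rfl | rfl)
    · rfl
    · exact fMap_iota Q

theorem fMap_surjective : Function.Surjective (fMap p) := by
  rintro (_ | ⟨x, y, h⟩)
  · exact ⟨.infty 1 (one_pow 2), rfl⟩
  · obtain ⟨a, rfl⟩ := IsAlgClosed.exists_pow_nat_eq x two_pos
    have h' := (E_equation_iff _ _).1 h.1
    exact ⟨.affine a y (by rw [h']; ring), rfl⟩

/-- The fibre of `f` through a point, counted with multiplicities. -/
def fibre (P : CPoint p) : Divisor p := Finsupp.single P 1 + Finsupp.single (iota p P) 1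

theorem fibre_iota (P : CPoint p) : fibre (iota p P) = fibre P := by
  rw [fibre, fibre, iota_iota, add_comm]

-- This coefficient is the ramification index of `f` at `P`; the ramification points are the fixed
-- points of `ι`, which are those with `x = 0`.
open Classical in
theorem fibre_self (P : CPoint p) : fibre P P = if iota p P = P then 2 else 1 := by
  rw [fibre, Finsupp.add_apply, Finsupp.single_eq_same, Finsupp.single_apply]
  split_ifs <;> rfl

theorem fibre_self_affine {a b : Fbar p} (h : b ^ 2 = a ^ 6 + 1) :
    fibre (.affine a b h) (.affine a b h) = if a = 0 then 2 else 1 := by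
  rw [fibre_self, iota_affine]
  have h1 : -a = a ↔ a = 0 := by
    rw [neg_eq_iff_add_eq_zero, ← two_mul, mul_eq_zero, or_iff_right (two_ne_zero_Fbar p)]
  simp [h1]

theorem fibre_self_infty {s : Fbar p} (h : s ^ 2 = 1) :
    fibre (.infty s h) (.infty s h) = 1 := by
  rw [fibre_self, iota_infty, if_neg]
  rw [CPoint.infty.injEq, neg_eq_iff_add_eq_zero, ← two_mul]
  exact mul_ne_zero (two_ne_zero_Fbar p) (ne_zero_of_sq_eq_one h)

theorem hasOrd_infty_y {s : Fbar p} (h : s ^ 2 = 1) : HasOrd (.infty s h) (yFun p) (-3) := by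
  have hx := pow_ne_zero 3 (xFun_ne_zero (p := p))
  have := (HasOrd.of_isUnitAt ((hasValue_infty_y h).isUnitAt (ne_zero_of_sq_eq_one h))).mul
    ((hasOrd_infty_x h).zpow 3)
  norm_cast at this
  rw [div_mul_cancel₀ _ hx] at this
  simpa using this

/-- At infinity `x²/y` has order `-2 + 3 = 1`. Where `y = 0` one has `a ≠ 0` and no ramification.
Elsewhere `x² - a² = (x - a)(x + a)`, where the second factor is a unit unless `a = 0`, when it
equals the first. -/
theorem hasOrd_uniformizerE (P : CPoint p) :
    HasOrd P (uniformizerE (xFun p ^ 2) (yFun p) (fMap p P)) (fibre P P) := by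
  cases P with
  | infty s h =>
    rw [fibre_self_infty]
    have := ((hasOrd_infty_x h).zpow 2).div (hasOrd_infty_y h)
    norm_num at this
    exact_mod_cast this
  | affine a b h =>
    rw [fibre_self_affine]
    simp only [fMap, ePoint, uniformizerE]
    by_cases hb : b = 0
    · have ha : a ≠ 0 := by
        rintro rfl
        rw [hb] at h
        norm_num at h
      simpa [ha, hb] using hasOrd_y h hb
    · have h1 := hasOrd_x_sub h hb
      have h2 : xFun p ^ 2 - algebraMap (Fbar p) _ (a ^ 2) =
          (xFun p - algebraMap (Fbar p) _ a) * (xFun p + algebraMap (Fbar p) _ a) := by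
        rw [map_pow]; ring
      rw [if_neg hb, h2]
      split_ifs with ha
      · have h3 : xFun p + algebraMap (Fbar p) _ a = xFun p - algebraMap (Fbar p) _ a := by
          rw [ha]; simp
        rw [h3]
        exact h1.mul h1
      · have h3 := (hasValue_x h).add (HasValue.const _ a)
        refine h1.mul (HasOrd.of_isUnitAt (h3.isUnitAt ?_))
        rw [← two_mul]
        exact mul_ne_zero (two_ne_zero_Fbar p) ha

theorem isPullback_fibre (P : CPoint p) :
    IsPullback (fMap p) (xFun p ^ 2) (yFun p) (fMap p P) (fibre P) := by
  refine fun Q => ⟨fun h => ?_, fun h => ?_⟩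
  · have h1 : fibre P = fibre Q := by
      rcases fMap_eq_fMap_iff.1 h with rfl | rfl
      · rfl
      · rw [fibre_iota]
    rw [← h, h1]
    exact hasOrd_uniformizerE Q
  · rw [fibre, Finsupp.add_apply, Finsupp.single_eq_of_ne, Finsupp.single_eq_of_ne, add_zero]
    · rintro rfl
      exact h (fMap_iota P)
    · rintro rfl
      exact h rfl

theorem IsPullback.unique {g : CPoint p → EPoint p} {U V : FunctionField p} {P : EPoint p}
    {D D' : Divisor p} (h : IsPullback g U V P D) (h' : IsPullback g U V P D') : D = D' := by
  ext Q
  by_cases hQ : g Q = P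
  · exact ((h Q).1 hQ).unique ((h' Q).1 hQ)
  · rw [(h Q).2 hQ, (h' Q).2 hQ]

theorem IsPullback.pullback_eq {g : CPoint p → EPoint p} {U V : FunctionField p} {P : EPoint p}
    {D : Divisor p} (h : IsPullback g U V P D) : pullback g U V P = D := by
  have he : ∃ D, IsPullback g U V P D := ⟨D, h⟩
  rw [pullback, dif_pos he]
  exact he.choose_spec.unique h

theorem fPull_fMap (P : CPoint p) : fPull (fMap p P) = fibre P :=
  (isPullback_fibre P).pullback_eq

theorem isPullback_fPull (P : EPoint p) :
    IsPullback (fMap p) (xFun p ^ 2) (yFun p) P (fPull P) := by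
  obtain ⟨Q, rfl⟩ := fMap_surjective P
  rw [fPull_fMap]
  exact isPullback_fibre Q

/-- Everything about `f'` is deduced from `f` through this identity. -/
theorem fMap_chi (P : CPoint p) : fMap p (chiC p P) = fMap' p P := by
  cases P with
  | affine a b h =>
    by_cases ha : a = 0
    · simp [chiC, fMap, fMap', ha]
    · simp [chiC, fMap, fMap', ha]
  | infty s h => simp [chiC, fMap, fMap']

theorem fMap'_chi (P : CPoint p) : fMap' p (chiC p P) = fMap p P := by
  rw [← fMap_chi, chiC_chiC]

/-- As `χ` is an involution, `χ_* = χ^*`, so `f'^* = χ^* f^* = χ_* f^*`. On functions, `chiField`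
turns the pull-back by `f` of a uniformizer into its pull-back by `f'`. -/
theorem isPullback_mapDomain_chi (P : EPoint p) :
    IsPullback (fMap' p) (1 / xFun p ^ 2) (yFun p / xFun p ^ 3) P
      ((fPull P).mapDomain (chiC p)) := by
  intro Q
  obtain ⟨Q, rfl⟩ := chiC_bijective.2 Q
  rw [fMap'_chi, Finsupp.mapDomain_apply chiC_bijective.1]
  refine ⟨fun h => ?_, (isPullback_fPull P Q).2⟩
  have h1 := hasOrd_chi ((isPullback_fPull P Q).1 h)
  convert h1 using 1
  cases P with
  | zero => simp [uniformizerE]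
  | some x y h =>
    simp only [uniformizerE]
    split_ifs <;> simp

theorem fPull'_eq (P : EPoint p) : fPull' P = (fPull P).mapDomain (chiC p) :=
  (isPullback_mapDomain_chi P).pullback_eq

theorem isPullback_fPull' (P : EPoint p) :
    IsPullback (fMap' p) (1 / xFun p ^ 2) (yFun p / xFun p ^ 3) P (fPull' P) := by
  rw [fPull'_eq]
  exact isPullback_mapDomain_chi P

/-! ### Pull-back of orders by `f` -/

theorem Y_ne_zero : CoordinateRing.mk (EBar p) X ≠ 0 := by
  simpa [CoordinateRing.YClass] using CoordinateRing.YClass_ne_zero (W' := EBar p) 0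

theorem algebraMap_E_ne_zero {r : (EBar p).CoordinateRing} (hr : r ≠ 0) :
    algebraMap _ (EBar p).FunctionField r ≠ 0 := by
  simpa using hr

theorem ordAt_X_sub {x y : Fbar p} (h : (EBar p).Nonsingular x y) :
    ordAt h (algebraMap _ (EBar p).FunctionField (CoordinateRing.XClass (EBar p) x)) =
      if y = 0 then 2 else 1 := by
  rw [ordAt_XClass h h, if_pos rfl]
  have h1 : -y = y ↔ y = 0 := by
    rw [neg_eq_iff_add_eq_zero, ← two_mul, mul_eq_zero, or_iff_right (two_ne_zero_Fbar p)]
  simp only [Point.neg_some, Point.some.injEq, true_and, EBar_negY, h1]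
  split_ifs <;> rfl

/-- At a point with `y = 0` one has `Y² = X³ - x³ = (X - x) q`. Here `X - x` has order two and `q`
takes the value `3x² ≠ 0`, so `Y` has order one. -/
theorem ordAt_Y {x y : Fbar p} (h : (EBar p).Nonsingular x y) (hy : y = 0) :
    ordAt h (algebraMap _ (EBar p).FunctionField (CoordinateRing.mk (EBar p) X)) = 1 := by
  have he := (E_equation_iff _ _).1 h.1
  let q : (EBar p).CoordinateRing := CoordinateRing.mk _ (C (X ^ 2 + C x * X + C (x ^ 2)))
  have hx3 : x ^ 3 = -1 := by
    rw [hy] at he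
    linear_combination -he
  have hx : x ≠ 0 := by
    rintro rfl
    norm_num at hx3
  have hq : q ∉ CoordinateRing.XYIdeal (EBar p) x (C y) := by
    intro hq
    -- Division with remainder: `q - (X + 2x)(X - x) = 3x²`.
    have h1 : CoordinateRing.mk (EBar p) (C (C (3 * x ^ 2))) ∈
        CoordinateRing.XYIdeal (EBar p) x (C y) := by
      have h2 := Ideal.mul_mem_left _ (CoordinateRing.mk (EBar p) (C (X + C (2 * x))))
        (XClass_mem_XYIdeal (W := EBar p) x (C y))
      have h3 := Ideal.sub_mem _ hq h2
      convert h3 using 1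
      rw [CoordinateRing.XClass, ← map_mul, ← map_sub, ← C_mul, ← C_sub]
      congr 2
      simp only [C_mul, C_pow, map_ofNat]
      ring
    refine (XYIdeal_isMaximal h.1).ne_top (Ideal.eq_top_of_isUnit_mem _ h1 ?_)
    exact (isUnit_iff_ne_zero.2 (mul_ne_zero (three_ne_zero_Fbar p) (pow_ne_zero 2 hx))).map
      ((CoordinateRing.mk (EBar p)).comp (C.comp C))
  have hmul : CoordinateRing.mk (EBar p) X * CoordinateRing.mk (EBar p) X =
      CoordinateRing.XClass _ x * q := by
    have h0 : CoordinateRing.mk (EBar p) (X ^ 2 - C (X ^ 3 + 1)) = 0 :=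
      (congrArg (CoordinateRing.mk (EBar p)) EBar_polynomial).symm.trans AdjoinRoot.mk_self
    rw [map_sub, sub_eq_zero] at h0
    rw [← map_mul, ← sq, h0, CoordinateRing.XClass, ← map_mul, ← C_mul]
    congr 2
    have h4 : (C x : (Fbar p)[X]) ^ 3 = -1 := by rw [← C_pow, hx3]; simp
    rw [C_pow]
    linear_combination h4
  have hY := algebraMap_E_ne_zero (Y_ne_zero (p := p))
  have hq0 : q ≠ 0 := fun h0 => hq (h0 ▸ zero_mem _)
  have h2 := congrArg (fun r => ordAt h (algebraMap _ (EBar p).FunctionField r)) hmul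
  simp only [map_mul] at h2
  rw [ordAt_mul h hY hY, ordAt_mul h (algebraMap_E_ne_zero (CoordinateRing.XClass_ne_zero x))
    (algebraMap_E_ne_zero hq0), ordAt_X_sub, if_pos hy, ordAt_algebraMap_eq_zero h hq] at h2
  omega

/-- Orders get multiplied by the ramification index: write `ψ` as a power of a uniformizer `t` times
a unit; the unit pulls back to a unit, and `t` to a function of order `fibre P P`. -/
theorem hasOrd_fField {P : CPoint p} {x y : Fbar p} {h : (EBar p).Nonsingular x y}
    (hP : fMap p P = .some x y h) {ψ : (EBar p).FunctionField} (hψ : ψ ≠ 0) :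
    HasOrd P (fField p ψ) (ordAt h ψ * fibre P P) := by
  have ht : ∃ t : (EBar p).FunctionField, t ≠ 0 ∧ ordAt h t = 1 ∧
      fField p t = uniformizerE (xFun p ^ 2) (yFun p) (.some x y h) := by
    by_cases hy : y = 0
    · exact ⟨_, algebraMap_E_ne_zero Y_ne_zero, ordAt_Y h hy,
        by rw [fField_Y, uniformizerE, if_pos hy]⟩
    · exact ⟨_, algebraMap_E_ne_zero (CoordinateRing.XClass_ne_zero x),
        by rw [ordAt_X_sub, if_neg hy], by simp [uniformizerE, hy]⟩
  obtain ⟨t, ht0, ht1, ht⟩ := ht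
  have h1 := hasOrd_uniformizerE P
  rw [hP, ← ht] at h1
  obtain ⟨r, s, hr, hs, he⟩ := exists_eq_zpow_ordAt_mul h ht0 ht1 hψ
  conv_lhs => rw [he]
  rw [map_mul, map_zpow₀, map_div₀, fField_algebraMap, fField_algebraMap]
  cases P with
  | infty s h' => exact absurd hP.symm (by simp [fMap])
  | affine a b h' =>
    simp only [fMap, ePoint, Point.some.injEq] at hP
    obtain ⟨rfl, rfl⟩ := hP
    have h2 := (h1.zpow (ordAt h ψ)).mul (HasOrd.of_isUnitAt
      ((isUnitAt_fRing h' hr).mul (isUnitAt_fRing h' hs).inv))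
    rw [add_zero, ← div_eq_mul_inv] at h2
    exact h2

/-! ### The norm from the function field of `C` to that of `E` -/

variable (p) in
/-- The pull-back of functions by `(x, y) ↦ (-x, y)`. -/
def iotaField : FunctionField p →+* FunctionField p := rhoField (-1) (by norm_num)

theorem hasOrd_iota {P : CPoint p} {φ : FunctionField p} {n : ℤ} (hφ : HasOrd P φ n) :
    HasOrd (iota p P) (iotaField p φ) n := hasOrd_rho _ hφ

theorem iotaField_x : iotaField p (xFun p) = -xFun p := by
  simp [iotaField, inv_neg]

theorem iotaField_fRing (r : (EBar p).CoordinateRing) :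
    iotaField p (algebraMap _ _ (fRing p r)) = algebraMap _ _ (fRing p r) := by
  have : ((iotaField p).comp (algebraMap _ _)).comp (fRing p) =
      (algebraMap (CoordRing p) (FunctionField p)).comp (fRing p) := by
    refine Ideal.Quotient.ringHom_ext (Polynomial.ringHom_ext' (Polynomial.ringHom_ext' ?_ ?_) ?_)
    · ext c
      change iotaField p (algebraMap _ _ (fRing p (CoordinateRing.mk _ (C (C c))))) =
        algebraMap _ _ (fRing p (CoordinateRing.mk _ (C (C c))))
      rw [fRing_C]
      exact rhoField_algebraMap _ c
    · change iotaField p (algebraMap _ _ (fRing p (CoordinateRing.mk _ (C X)))) =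
        algebraMap _ _ (fRing p (CoordinateRing.mk _ (C X)))
      rw [fRing_X, map_pow, map_pow]
      change iotaField p (xFun p) ^ 2 = xFun p ^ 2
      rw [iotaField_x, neg_sq]
    · change iotaField p (algebraMap _ _ (fRing p (CoordinateRing.mk _ X))) =
        algebraMap _ _ (fRing p (CoordinateRing.mk _ X))
      rw [fRing_Y]
      exact rhoField_y _
  exact RingHom.congr_fun this r

theorem exists_eq_fRing_add (r : CoordRing p) :
    ∃ s t : (EBar p).CoordinateRing, r = fRing p s + AdjoinRoot.of _ X * fRing p t := by
  induction r using coordRing_induction with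
  | const c => exact ⟨CoordinateRing.mk _ (C (C c)), 0, by rw [fRing_C, map_zero]; ring⟩
  | add r r' hr hr' =>
    obtain ⟨s, t, rfl⟩ := hr
    obtain ⟨s', t', rfl⟩ := hr'
    refine ⟨s + s', t + t', ?_⟩
    simp only [map_add]
    ring
  | mul_x r hr =>
    obtain ⟨s, t, rfl⟩ := hr
    refine ⟨CoordinateRing.mk _ (C X) * t, s, ?_⟩
    rw [map_mul, fRing_X]
    ring
  | mul_y r hr =>
    obtain ⟨s, t, rfl⟩ := hr
    refine ⟨CoordinateRing.mk _ X * s, CoordinateRing.mk _ X * t, ?_⟩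
    rw [map_mul, map_mul, fRing_Y]
    ring

/-- Since `ι` changes the sign of `x` and fixes the functions coming from `E`, the product is `(s +
x t)(s - x t) = s² - x² t²`, and `x²` is the pull-back of `X`. -/
theorem exists_mul_iotaField_algebraMap_eq (r : CoordRing p) :
    ∃ s : (EBar p).CoordinateRing, algebraMap _ (FunctionField p) r *
      iotaField p (algebraMap _ _ r) = fField p (algebraMap _ _ s) := by
  obtain ⟨s, t, rfl⟩ := exists_eq_fRing_add r
  refine ⟨s ^ 2 - CoordinateRing.mk _ (C X) * t ^ 2, ?_⟩
  rw [fField_algebraMap, map_sub, map_mul, map_pow, map_pow, fRing_X]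
  simp only [map_add, map_mul, map_sub, map_pow, iotaField_fRing]
  change (_ + xFun p * _) * (_ + iotaField p (xFun p) * _) = _ - xFun p ^ 2 * _
  rw [iotaField_x]
  ring

/-- The norm of a function on `C` is a function on `E`. -/
theorem exists_mul_iotaField_eq (φ : FunctionField p) :
    ∃ ψ, φ * iotaField p φ = fField p ψ := by
  obtain ⟨r, s, hs, rfl⟩ := IsFractionRing.div_surjective (A := CoordRing p) φ
  obtain ⟨r', hr'⟩ := exists_mul_iotaField_algebraMap_eq r
  obtain ⟨s', hs'⟩ := exists_mul_iotaField_algebraMap_eq s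
  refine ⟨algebraMap _ _ r' / algebraMap _ _ s', ?_⟩
  rw [map_div₀, map_div₀, ← hr', ← hs', div_mul_div_comm]

/-! ### Push-forward of divisors by `f` -/

/-- The coefficient at `P` of `f^* f_* D = D + ι_* D`. At a fixed point of `ι` the fibre is a single
point, and the ramification index two makes up for it. -/
theorem fibre_self_mul_mapDomain (D : Divisor p) (P : CPoint p) :
    fibre P P * D.mapDomain (fMap p) (fMap p P) = D P + D (iota p P) := by
  classical
  induction D using Finsupp.induction_linear with
  | zero => simp
  | add D D' h h' =>
    rw [Finsupp.mapDomain_add, Finsupp.add_apply, mul_add, h, h', Finsupp.add_apply,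
      Finsupp.add_apply]
    ring
  | single Q n =>
    rw [Finsupp.mapDomain_single, fibre_self]
    simp only [Finsupp.single_apply, fMap_eq_fMap_iff]
    by_cases h1 : Q = P
    · subst h1
      by_cases h2 : iota p Q = Q
      · simp [h2, two_mul]
      · simp [h2, Ne.symm h2]
    · by_cases h2 : Q = iota p P
      · have h3 : iota p P ≠ P := fun h3 => h1 (h2.trans h3)
        simp [h2, h3]
      · simp [h1, h2]

theorem fibre_self_ne_zero (P : CPoint p) : fibre P P ≠ 0 := by
  rw [fibre_self]
  split_ifs <;> norm_num

/-- The push-forward by `f` of a principal divisor sums to zero. -/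
theorem sum_fMap_eq_zero {D : Divisor p} (hD : D ∈ Principal p) :
    D.sum (fun P n => n • fMap p P) = 0 := by
  obtain ⟨φ, hφ, h⟩ := hD
  obtain ⟨ψ, hψ⟩ := exists_mul_iotaField_eq φ
  have hψ0 : ψ ≠ 0 := by
    rintro rfl
    rw [map_zero, mul_eq_zero, map_eq_zero, or_self] at hψ
    exact hφ hψ
  -- At `P` the norm has order `D P + D (ι P)`, that is, the ramification index times the
  -- coefficient of `f_* D`. As the pull-back of `ψ` it has order the same index times that of `ψ`.
  -- The index cancels.
  have h1 := sum_smul_eq_zero_of_ordAt (D.mapDomain (fMap p)) hψ0 fun x y hE => by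
    obtain ⟨P, hP⟩ := fMap_surjective (Point.some x y hE)
    have h2 := hasOrd_iota (h (iota p P))
    rw [iota_iota] at h2
    have h3 := (h P).mul h2
    rw [hψ] at h3
    have h4 := h3.unique (hasOrd_fField hP hψ0)
    rw [← fibre_self_mul_mapDomain, mul_comm] at h4
    rw [← hP]
    exact (mul_right_cancel₀ (fibre_self_ne_zero P) h4).symm
  rwa [Finsupp.sum_mapDomain_index (by simp) (by intros; rw [add_smul])] at h1

/-- The homomorphism `∑ n_P P ↦ (∑ n_P f(P), ∑ n_P f'(P))` on divisors. -/
def fSum : Divisor p →+ EPoint p × EPoint p :=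
  Finsupp.liftAddHom fun P => (zmultiplesHom (EPoint p × EPoint p)) (fMap p P, fMap' p P)

@[simp]
theorem fSum_single (P : CPoint p) (n : ℤ) :
    fSum (Finsupp.single P n) = n • (fMap p P, fMap' p P) := by
  simp [fSum]

theorem muTildeDivisor_apply (D : DivisorZero p) : muTildeDivisor p D = fSum (D : Divisor p) := by
  have : AddMonoidHom.prod
      (Finsupp.liftAddHom fun P => (zmultiplesHom (EPoint p)) (fMap p P))
      (Finsupp.liftAddHom fun P => (zmultiplesHom (EPoint p)) (fMap' p P)) = fSum (p := p) := by
    ext P <;> simp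
  exact DFunLike.congr_fun this (D : Divisor p)

theorem fSum_mapDomain {α : CPoint p → CPoint p} {M : AddMonoid.End (EPoint p × EPoint p)}
    (h : ∀ P, (fMap p (α P), fMap' p (α P)) = M (fMap p P, fMap' p P)) (D : Divisor p) :
    fSum (D.mapDomain α) = M (fSum D) := by
  have : fSum.comp (Finsupp.mapDomain.addMonoidHom α) = AddMonoidHom.comp M (fSum (p := p)) := by
    refine Finsupp.addHom_ext fun P n => ?_
    simp only [AddMonoidHom.comp_apply, Finsupp.mapDomain.addMonoidHom_apply,
      Finsupp.mapDomain_single, fSum_single, h]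
    exact ((congrArg M (fSum_single P n)).trans (map_zsmul M n _)).symm
  exact DFunLike.congr_fun this D

theorem fSum_fst (D : Divisor p) : (fSum D).1 = D.sum (fun P n => n • fMap p P) := by
  rw [fSum, Finsupp.liftAddHom_apply, Finsupp.sum, Prod.fst_sum]
  rfl

theorem fSum_mapDomain_chi (D : Divisor p) : fSum (D.mapDomain (chiC p)) = (fSum D).swap :=
  fSum_mapDomain (M := AddEquiv.prodComm.toAddMonoidHom)
    (fun P => by rw [fMap_chi, fMap'_chi]; rfl) D

theorem fSum_eq_zero {D : Divisor p} (hD : D ∈ Principal p) : fSum D = 0 := by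
  have h1 := sum_fMap_eq_zero hD
  have h2 := sum_fMap_eq_zero (mapDomain_chi_mem_principal hD)
  rw [← fSum_fst] at h1 h2
  rw [fSum_mapDomain_chi] at h2
  exact Prod.ext h1 h2

theorem muTilde_mk (D : DivisorZero p) :
    muTilde p (QuotientAddGroup.mk D) = muTildeDivisor p D := by
  refine induced_mk (fun D hD => ?_) D
  rw [AddMonoidHom.mem_ker, muTildeDivisor_apply]
  exact fSum_eq_zero hD

/-! ### Additivity of `μ` -/

theorem fPull_apply (P : EPoint p) (Q : CPoint p) :
    fPull P Q = if fMap p Q = P then fibre Q Q else 0 := by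
  split_ifs with h
  · rw [← h, fPull_fMap]
  · exact (isPullback_fPull P Q).2 h

theorem fPull_zero : fPull (0 : EPoint p) = divInfty p := by
  have h := fPull_fMap (p := p) (.infty 1 (one_pow 2))
  rw [fibre, iota_infty] at h
  exact h

theorem divInfty_affine {a b : Fbar p} (h : b ^ 2 = a ^ 6 + 1) :
    divInfty p (.affine a b h) = 0 := by
  simp [divInfty]

theorem divInfty_infty {s : Fbar p} (h : s ^ 2 = 1) : divInfty p (.infty s h) = 1 := by
  rw [← fPull_zero, fPull_apply, fMap, if_pos rfl, fibre_self_infty]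

/-- The orders on `E` are defined only at affine points, so the behaviour over the origin enters as
a separate condition. -/
theorem mem_principal_of_ordAt {D : Divisor p} {ψ : (EBar p).FunctionField} (hψ : ψ ≠ 0)
    (hD : ∀ (P : CPoint p) (x y : Fbar p) (h : (EBar p).Nonsingular x y),
      fMap p P = .some x y h → D P = ordAt h ψ * fibre P P)
    (hinf : ∀ (s : Fbar p) (h : s ^ 2 = 1),
      HasOrd (.infty s h) (fField p ψ) (D (.infty s h))) : D ∈ Principal p := by
  refine ⟨fField p ψ, (_root_.map_ne_zero _).2 hψ, fun P => ?_⟩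
  cases P with
  | infty s h => exact hinf s h
  | affine a b h =>
    rw [hD (.affine a b h) _ _ _ rfl]
    exact hasOrd_fField rfl hψ

theorem hasOrd_infty_x_sq_sub {s : Fbar p} (h : s ^ 2 = 1) (c : Fbar p) :
    HasOrd (.infty s h) (xFun p ^ 2 - algebraMap (Fbar p) _ c) (-2) := by
  have hx := xFun_ne_zero (p := p)
  have h1 := (HasValue.one (.infty s h)).sub
    ((HasValue.const _ c).mul ((hasValue_infty_x h).pow 2))
  have h2 := ((hasOrd_infty_x h).zpow 2).mul (HasOrd.of_isUnitAt (h1.isUnitAt (by simp)))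
  have h3 : xFun p ^ 2 - algebraMap (Fbar p) _ c =
      xFun p ^ (2 : ℤ) * (1 - algebraMap (Fbar p) _ c * (xFun p)⁻¹ ^ 2) := by
    norm_cast
    field_simp
  rw [h3]
  simpa using h2

/-- Factor out `x³`: what remains is `y/x³ - e/x + (ec - d)/x³`, whose value at infinity is `s ≠ 0`.
-/
theorem hasOrd_infty_line {s : Fbar p} (h : s ^ 2 = 1) (c d e : Fbar p) :
    HasOrd (.infty s h) (yFun p - (algebraMap (Fbar p) _ e *
      (xFun p ^ 2 - algebraMap (Fbar p) _ c) + algebraMap (Fbar p) _ d)) (-3) := by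
  have hx := xFun_ne_zero (p := p)
  have hx' := hasValue_infty_x h
  have h1 := ((hasValue_infty_y h).sub ((HasValue.const _ e).mul hx')).add
    ((HasValue.const _ (e * c - d)).mul (hx'.pow 3))
  have h2 := ((hasOrd_infty_x h).zpow 3).mul
    (HasOrd.of_isUnitAt (h1.isUnitAt (by simpa using ne_zero_of_sq_eq_one h)))
  convert h2 using 1
  · norm_cast
    simp only [map_sub, map_mul]
    field_simp
    ring
  · norm_num

/-- The function is the pull-back of the vertical line through `Q` if `P = -Q`, and of the quotient
from `ordAt_line` otherwise. -/
theorem fPull_add_mem_principal (P Q : EPoint p) :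
    fPull P + fPull Q - fPull (P + Q) - divInfty p ∈ Principal p := by
  rcases P with _ | ⟨x₁, y₁, h₁⟩
  · rw [← Point.zero_def, zero_add, fPull_zero]
    convert zero_mem (Principal p) using 1
    abel
  rcases Q with _ | ⟨x₂, y₂, h₂⟩
  · rw [← Point.zero_def, add_zero, fPull_zero]
    convert zero_mem (Principal p) using 1
    abel
  have hne : ∀ {x y : Fbar p} {h : (EBar p).Nonsingular x y}, (0 : EPoint p) ≠ .some x y h :=
    fun {x y h} => (Point.some_ne_zero h).symm
  by_cases hxy : x₁ = x₂ ∧ y₁ = (EBar p).negY x₂ y₂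
  · have h12 : Point.some x₁ y₁ h₁ = -Point.some x₂ y₂ h₂ := by
      rw [Point.neg_some, Point.some.injEq]
      exact hxy
    have h0 : Point.some x₁ y₁ h₁ + Point.some x₂ y₂ h₂ = 0 := by rw [h12, neg_add_cancel]
    -- The two rewrites turn `divInfty` into `fPull 0`, so that the divisor is `f^*(P) + f^*(Q) - 2
    -- f^*(0)`, of coefficient `-2` at infinity.
    rw [h0, fPull_zero, ← fPull_zero]
    refine mem_principal_of_ordAt
      (algebraMap_E_ne_zero (CoordinateRing.XClass_ne_zero x₂)) (fun P x y h hP => ?_)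
      fun s h => ?_
    · simp only [Finsupp.sub_apply, Finsupp.add_apply, fPull_apply, hP]
      rw [ordAt_XClass h h₂, ← h12]
      simp only [eq_comm (a := Point.some x y h), if_neg hne]
      split_ifs <;> ring
    · rw [fField_XClass]
      convert hasOrd_infty_x_sq_sub h x₂ using 1
      simp only [Finsupp.sub_apply, Finsupp.add_apply, fPull_apply, fMap, if_neg hne, if_true,
        fibre_self_infty]
      norm_num
  · have hsum : Point.some x₁ y₁ h₁ + Point.some x₂ y₂ h₂ ≠ 0 := by
      rw [Point.add_some hxy]
      exact Point.some_ne_zero _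
    rw [← fPull_zero]
    refine mem_principal_of_ordAt
      (div_ne_zero (algebraMap_E_ne_zero (CoordinateRing.YClass_ne_zero
          (WeierstrassCurve.Affine.linePolynomial x₁ y₁ ((EBar p).slope x₁ x₂ y₁ y₂))))
        (algebraMap_E_ne_zero (CoordinateRing.XClass_ne_zero
          ((EBar p).addX x₁ x₂ ((EBar p).slope x₁ x₂ y₁ y₂))))) (fun P x y h hP => ?_)
      fun s h => ?_
    · simp only [Finsupp.sub_apply, Finsupp.add_apply, fPull_apply, hP]
      rw [ordAt_line h h₁ h₂ hxy]
      simp only [eq_comm (a := Point.some x y h), if_neg hne]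
      split_ifs <;> ring
    · rw [map_div₀, fField_XClass, fField_line]
      -- Here `P + Q ≠ 0`, so the coefficient at infinity is `-1 = -3 - (-2)`.
      convert (hasOrd_infty_line h _ _ _).div (hasOrd_infty_x_sq_sub h _) using 1
      simp only [Finsupp.sub_apply, Finsupp.add_apply, fPull_apply, fMap, if_neg hne, if_true,
        if_neg hsum.symm, fibre_self_infty]
      norm_num

/-- The divisor of the function `x`. -/
theorem divInfty_chi_mem_principal :
    (divInfty p).mapDomain (chiC p) - divInfty p ∈ Principal p := by
  refine ⟨xFun p, xFun_ne_zero, fun P => ?_⟩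
  have h1 : (divInfty p).mapDomain (chiC p) P = divInfty p (chiC p P) := by
    conv_lhs => rw [← chiC_chiC P]
    exact Finsupp.mapDomain_apply chiC_bijective.1 _ _
  rw [Finsupp.sub_apply, h1]
  cases P with
  | infty s h =>
    rw [divInfty_infty]
    simpa [chiC, divInfty_affine] using hasOrd_infty_x h
  | affine a b h =>
    rw [divInfty_affine]
    by_cases ha : a = 0
    · subst ha
      have hb : b ≠ 0 := by
        rintro rfl
        norm_num at h
      simpa [chiC, divInfty_infty] using hasOrd_x_sub h hb
    · simpa [chiC, divInfty_affine, ha] using HasOrd.of_isUnitAt ((hasValue_x h).isUnitAt ha)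

/-- The defect is the one for `f`, plus the `χ`-image of the one for `f`, plus `χ_*(∞₊ + ∞₋) - (∞₊ +
∞₋)`; the last term corrects `χ_*(∞₊ + ∞₋)` to `∞₊ + ∞₋`. -/
theorem muDivisor_add (R S : EPoint p × EPoint p) :
    muDivisor R + muDivisor S - muDivisor (R + S) ∈ Principal p := by
  have h1 := fPull_add_mem_principal R.1 S.1
  have h2 := mapDomain_chi_mem_principal (fPull_add_mem_principal R.2 S.2)
  have h3 := divInfty_chi_mem_principal (p := p)
  have hm : ∀ D : Divisor p, D.mapDomain (chiC p) = Finsupp.mapDomain.addMonoidHom (chiC p) D :=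
    fun _ => rfl
  convert add_mem (add_mem h1 h2) h3 using 1
  simp only [muDivisor, fPull'_eq, hm, map_sub, map_add, Prod.fst_add, Prod.snd_add]
  abel

@[simp]
theorem degree_single (P : CPoint p) (n : ℤ) : degree p (Finsupp.single P n) = n := by
  simp [degree]

theorem degree_mapDomain (α : CPoint p → CPoint p) (D : Divisor p) :
    degree p (D.mapDomain α) = degree p D := by
  have : (degree p).comp (Finsupp.mapDomain.addMonoidHom α) = degree p :=
    Finsupp.addHom_ext fun P n => by simp
  exact DFunLike.congr_fun this D

theorem degree_fPull (P : EPoint p) : degree p (fPull P) = 2 := by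
  obtain ⟨Q, rfl⟩ := fMap_surjective P
  rw [fPull_fMap, fibre, map_add, degree_single, degree_single]
  rfl

theorem muDivisor_mem (R : EPoint p × EPoint p) : muDivisor R ∈ DivisorZero p := by
  rw [AddMonoidHom.mem_ker, muDivisor, fPull'_eq, ← fPull_zero, map_sub, map_add, map_nsmul,
    degree_mapDomain, degree_fPull, degree_fPull, degree_fPull]
  rfl

theorem divisorClass_eq {D : Divisor p} (h : D ∈ DivisorZero p) :
    divisorClass D = QuotientAddGroup.mk ⟨D, h⟩ := by
  rw [divisorClass, dif_pos h]

theorem mu_apply (R : EPoint p × EPoint p) :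
    mu p R = QuotientAddGroup.mk ⟨muDivisor R, muDivisor_mem R⟩ := by
  have h : ∀ R S : EPoint p × EPoint p, divisorClass (muDivisor (R + S)) =
      divisorClass (muDivisor R) + divisorClass (muDivisor S) := by
    intro R S
    rw [divisorClass_eq (muDivisor_mem _), divisorClass_eq (muDivisor_mem _),
      divisorClass_eq (muDivisor_mem _), ← QuotientAddGroup.mk_add, QuotientAddGroup.eq]
    have := muDivisor_add R S
    rw [sub_eq_neg_add] at this
    exact this
  rw [mu, dif_pos h]
  exact divisorClass_eq _

/-! ### The images of endomorphisms under `T` -/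

theorem neg_ePoint {x y : Fbar p} (h : y ^ 2 = x ^ 3 + 1) :
    -ePoint x y h = ePoint x (-y) (by rw [neg_sq, h]) := by
  simp only [ePoint, Point.neg_some, EBar_negY]

theorem fMap'_iota (P : CPoint p) : fMap' p (iota p P) = -fMap' p P := by
  cases P with
  | affine a b h =>
    by_cases ha : a = 0
    · simp [iota_affine, fMap', ha]
    · have h3 : (-a) ^ 3 = -a ^ 3 := Odd.neg_pow (by decide) a
      simp [iota_affine, fMap', ha, neg_ePoint, h3, div_neg]
  | infty s h => simp [iota_infty, fMap', neg_ePoint]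

/-- On a fibre `{Q, ι Q}` the values of `f` agree and those of `f'` cancel. -/
theorem fSum_fPull (P : EPoint p) : fSum (fPull P) = (2 • P, 0) := by
  obtain ⟨Q, rfl⟩ := fMap_surjective P
  rw [fPull_fMap, fibre, map_add, fSum_single, fSum_single, one_smul, one_smul, fMap_iota,
    fMap'_iota, Prod.mk_add_mk, add_neg_cancel, two_smul]

theorem fSum_muDivisor (R : EPoint p × EPoint p) : fSum (muDivisor R) = 2 • R := by
  rw [muDivisor, ← fPull_zero, map_sub, map_nsmul, map_add, fPull'_eq, fSum_mapDomain_chi,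
    fSum_fPull, fSum_fPull, fSum_fPull]
  ext <;> simp

/-- The image under `T` of the endomorphism induced by a map `α` is determined by the action of `α`
on the images of points in `E × E`. -/
theorem T_inducedEnd {α : CPoint p → CPoint p} {M : AddMonoid.End (EPoint p × EPoint p)}
    (hα : ∀ D ∈ Principal p, D.mapDomain α ∈ Principal p)
    (h : ∀ P, (fMap p (α P), fMap' p (α P)) = M (fMap p P, fMap' p P)) :
    T p (inducedEnd α) = 2 • M := by
  apply AddMonoidHom.ext
  intro R
  change muTilde p (inducedEnd α (mu p R)) = 2 • M R
  rw [mu_apply, inducedEnd_mk hα, muTilde_mk, muTildeDivisor_apply]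
  change fSum (Finsupp.mapDomain α (muDivisor R)) = _
  rw [fSum_mapDomain h, fSum_muDivisor, map_nsmul]

theorem matrixEnd_apply {A : Type*} [AddCommGroup A]
    (M : Matrix (Fin 2) (Fin 2) (AddMonoid.End A)) (a b : A) :
    matrixEnd M (a, b) = (M 0 0 a + M 0 1 b, M 1 0 a + M 1 1 b) := rfl

theorem piE_some {x y : Fbar p} (h : y ^ 2 = x ^ 3 + 1) (h' : (y ^ p) ^ 2 = (x ^ p) ^ 3 + 1) :
    piE p (ePoint x y h) = ePoint (x ^ p) (y ^ p) h' := by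
  refine (Point.map_some ..).trans ?_
  simp [ePoint]

theorem fMap_frob (P : CPoint p) : fMap p (frobC p P) = piE p (fMap p P) := by
  cases P with
  | affine a b h =>
    simp only [fMap, frobC]
    rw [piE_some _ (by rw [← pow_mul, mul_comm p 2, pow_mul, h, add_pow_char]; ring)]
    simp [ePoint, ← pow_mul, mul_comm]
  | infty s h => exact (map_zero (piE p)).symm

/-- `χ` is defined over the prime field. This carries the compatibility of Frobenius with `f` over
to `f'`. -/
theorem chiC_frobC (P : CPoint p) : chiC p (frobC p P) = frobC p (chiC p P) := by
  have hp : p ≠ 0 := (Fact.out : p.Prime).ne_zero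
  cases P with
  | affine a b h =>
    by_cases ha : a = 0
    · simp [chiC, frobC, ha, hp]
    · simp [chiC, frobC, ha, hp, div_pow, ← pow_mul, mul_comm]
  | infty s h => simp [chiC, frobC, hp]

theorem fMap'_frob (P : CPoint p) : fMap' p (frobC p P) = piE p (fMap' p P) := by
  rw [← fMap_chi, ← fMap_chi, chiC_frobC, fMap_frob]

theorem fMap_rho {ζ : Fbar p} (hζ : IsPrimitiveRoot ζ 6) (P : CPoint p) :
    fMap p (rhoC ζ hζ.pow_eq_one P) = rho3 p (ζ ^ 2) (cube_sq_eq_one hζ) (fMap p P) := by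
  cases P with
  | affine a b h =>
    simp only [fMap, rhoC, mul_pow]
    rfl
  | infty s h => exact (map_zero (rho3 p (ζ ^ 2) (cube_sq_eq_one hζ))).symm

theorem cube_eq_neg_one {ζ : Fbar p} (hζ : IsPrimitiveRoot ζ 6) : ζ ^ 3 = -1 := by
  have h1 : (ζ ^ 3 - 1) * (ζ ^ 3 + 1) = 0 := by linear_combination hζ.pow_eq_one
  rcases mul_eq_zero.1 h1 with h2 | h2
  · exact absurd (sub_eq_zero.1 h2) (hζ.pow_ne_one_of_pos_of_lt (by norm_num) (by norm_num))
  · exact eq_neg_of_add_eq_zero_left h2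

theorem rho3_ePoint {z : Fbar p} (hz : z ^ 3 = 1) {x y : Fbar p} (h : y ^ 2 = x ^ 3 + 1) :
    rho3 p z hz (ePoint x y h) = ePoint (z * x) y (by rw [mul_pow, hz, one_mul, h]) := rfl

/-- `1/(ζx)² = ζ⁴/x²` because `ζ⁶ = 1`, which is `ρ₃` applied twice; `(ζx)³ = -x³` because `ζ³ =
-1`, which produces the sign. -/
theorem fMap'_rho {ζ : Fbar p} (hζ : IsPrimitiveRoot ζ 6) (P : CPoint p) :
    fMap' p (rhoC ζ hζ.pow_eq_one P) =
      -(rho3 p (ζ ^ 2) (cube_sq_eq_one hζ) (rho3 p (ζ ^ 2) (cube_sq_eq_one hζ) (fMap' p P))) := by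
  have h3 := cube_eq_neg_one hζ
  have h6 := hζ.pow_eq_one
  have h0 := ne_zero_of_pow_six h6
  cases P with
  | affine a b h =>
    by_cases ha : a = 0
    · simp [fMap', rhoC, ha]
    · have h4 : ((ζ * a) ^ 2)⁻¹ = ζ ^ 2 * (ζ ^ 2 * (a ^ 2)⁻¹) := by
        field_simp
        linear_combination -h6
      simp only [fMap', rhoC, ha, h0, mul_eq_zero, or_self, dif_neg, not_false_eq_true,
        rho3_ePoint, neg_ePoint]
      simp [mul_pow, h3, div_neg, ← h4]
  | infty s h =>
    simp only [fMap', rhoC, rho3_ePoint, neg_ePoint]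
    simp [h3, div_neg]

end SexticJacobian

end

theorem mainTheorem11 (p : ℕ) [Fact p.Prime] [Fact (p ≠ 2)] [Fact (p % 3 = 2)]
    (ζ₆ : Fbar p) (hζ₆ : IsPrimitiveRoot ζ₆ 6) :
    -- The pull-backs of points by `f` and `f'` are well defined.
    (∀ P, IsPullback (fMap p) (xFun p ^ 2) (yFun p) P (fPull P)) ∧
    (∀ P, IsPullback (fMap' p) (1 / xFun p ^ 2) (yFun p / xFun p ^ 3) P (fPull' P)) ∧
    -- The homomorphisms `μ`, `μ̃` and the endomorphisms `π_C`, `χ`, `ρ₆` of `Jac(C)` are well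
    -- defined: they are given by the following formulas.
    (∀ R, ∃ h : muDivisor R ∈ DivisorZero p,
      mu p R = QuotientAddGroup.mk ⟨muDivisor R, h⟩) ∧
    (∀ D : DivisorZero p, muTilde p (QuotientAddGroup.mk D) = muTildeDivisor p D) ∧
    (∀ D : DivisorZero p, piJac p (QuotientAddGroup.mk D) =
      QuotientAddGroup.mk (pushDivisor (frobC p) D)) ∧
    (∀ D : DivisorZero p, chiJac p (QuotientAddGroup.mk D) =
      QuotientAddGroup.mk (pushDivisor (chiC p) D)) ∧
    (∀ D : DivisorZero p, rho6Jac ζ₆ hζ₆.pow_eq_one (QuotientAddGroup.mk D) =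
      QuotientAddGroup.mk (pushDivisor (rhoC ζ₆ hζ₆.pow_eq_one) D)) ∧
    -- The images of `π_C`, `χ` and `ρ₆` under `T`; here `ζ₃ = ζ₆ ^ 2`.
    T p (piJac p) = 2 • matrixEnd !![piE p, 0; 0, piE p] ∧
    T p (chiJac p) = 2 • matrixEnd !![0, 1; 1, 0] ∧
    T p (rho6Jac ζ₆ hζ₆.pow_eq_one) =
      2 • matrixEnd !![rho3 p (ζ₆ ^ 2) (cube_sq_eq_one hζ₆), 0;
        0, -(rho3 p (ζ₆ ^ 2) (cube_sq_eq_one hζ₆)) ^ 2] := by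

  refine ⟨isPullback_fPull, isPullback_fPull', fun R => ⟨muDivisor_mem R, mu_apply R⟩, muTilde_mk,
    inducedEnd_mk fun _ => mapDomain_frob_mem_principal,
    inducedEnd_mk fun _ => mapDomain_chi_mem_principal,
    inducedEnd_mk fun _ => mapDomain_rho_mem_principal _, ?_, ?_, ?_⟩
  · refine T_inducedEnd (fun _ => mapDomain_frob_mem_principal) fun P => ?_
    rw [fMap_frob, fMap'_frob]
    simp [matrixEnd_apply]
  · refine T_inducedEnd (fun _ => mapDomain_chi_mem_principal) fun P => ?_
    rw [fMap_chi, fMap'_chi]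
    simp [matrixEnd_apply]
  · refine T_inducedEnd (fun _ => mapDomain_rho_mem_principal _) fun P => ?_
    rw [fMap_rho hζ₆, fMap'_rho hζ₆]
    simp [matrixEnd_apply, sq]
    rfl
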